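/- **The game.** Let $\alpha\ge 1$ be real and $k\ge 1$ an integer. In local-knowledge MaxNCG on a finite player set $V$ with $|V|=n$, a strategy profile $\sigma=(\sigma_u)_{u\in V}$ assigns to each player $u$ a set $\sigma_u\subseteq V\setminus\{u\}$. The network $G(\sigma)$ is the undirected graph on $V$ with edges $\{uv : v\in\sigma_u\}$. The cost of $u$ is $$C_u(\sigma)=\alpha|\sigma_u|+\max_{v\in V}d_{G(\sigma)}(u,v)$$ ($+\infty$ if $G(\sigma)$ is disconnected), and the social cost is $\mathrm{SC}(\sigma)=\sum_{u}C_u(\sigma)$. Player $u$ knows only $k$, her own strategy $\sigma_u$ and her view, i.e. the subgraph of $G(\sigma)$ induced by the vertices at distance at most $k$ from $u$; she does not know $n$, and may switch only to a set $\sigma_u'$ of vertices (other than $u$) of her view. A profile $\tau$, on any finite set of players, is realizable for $u$ if $G(\tau)$ is connected, $u$ plays $\sigma_u$ in $\tau$, and $u$ has the same view (up to renaming of the players) in $G(\tau)$ as in $G(\sigma)$. Let $$\Delta(\sigma_u,\sigma'_u)=\sup_{\tau\ \text{realizable for } u}\bigl(C_u(\tau_{-u},\sigma'_u)-C_u(\tau)\bigr).$$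 The profile $\sigma$ is a local knowledge equilibrium (LKE) if $G(\sigma)$ is connected and $\Delta(\sigma_u,\sigma_u')\ge 0$ for every player $u$ and every admissible $\sigma_u'$. Finally, $\mathrm{OPT}_\alpha(n)$ is the minimum social cost over all profiles of $n$ players, and $\mathrm{PoA}(n,k,\alpha)$ is the maximum of $\mathrm{SC}(\sigma)/\mathrm{OPT}_\alpha(n)$ over all LKEs $\sigma$ of $n$ players. **Claim.** There is an absolute constant $c>0$ such that the following two statements hold. 1. For every sequence of integers $k(n)\ge 2$ with $k(n)=o(\log n)$ and every sequence of reals $\alpha(n)\ge 1$, for all sufficiently large $n$, $$\mathrm{PoA}(n,k(n),\alpha(n))\ \ge\ c\,n^{\frac{1}{2k(n)-2}} .$$ 2. (Regular dense witnesses.) For every integer $k\ge2$ and every prime power $q\ge 3$ there are an integer $n$ and a profile $\sigma$ of $n$ players whose network $G(\sigma)$ is $q$-regular, has girth at least $2k+2$ and has at least $c\,n^{1+\frac1{2k-2}}$ edges, and such that for every real $\alpha\ge1$ the profile $\sigma$ is an LKE (for the parameters $\alpha,k$) with $\mathrm{SC}(\sigma)\ge c\,n^{\frac1{2k-2}}\,\mathrm{OPT}_\alpha(n)$.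 -/

import Mathlib

open Filter Asymptotics

noncomputable section

/-- A (pure) strategy profile of a network creation game on the set of players `V`:
player `u` buys the links towards the players in `bought u`, a subset of `V \ {u}`. -/
structure Profile (V : Type) where
  bought : V → Finset V
  irrefl : ∀ u, u ∉ bought u

namespace Profile

variable {V : Type}

/-- The undirected network activated by the profile. -/
def network (σ : Profile V) : SimpleGraph V where
  Adj u v := v ∈ σ.bought u ∨ u ∈ σ.bought v
  symm := ⟨fun _ _ h => h.symm⟩
  loopless := ⟨fun u h => h.elim (σ.irrefl u) (σ.irrefl u)⟩

open Classical in
/-- The profile in which player `u` switches to the strategy `T`, the others being unchanged. -/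
def deviate (σ : Profile V) (u : V) (T : Finset V) (hT : u ∉ T) : Profile V where
  bought := Function.update σ.bought u T
  irrefl := by
    intro v
    by_cases h : v = u
    · subst h
      simpa using hT
    · simpa [Function.update_of_ne h] using σ.irrefl v

/-- The cost of player `u` in MaxNCG: `α` times the number of links she buys, plus her
eccentricity in the network (which is `⊤` if the network is disconnected). -/
def cost (α : ℝ) (σ : Profile V) (u : V) : EReal :=
  ((α * ((σ.bought u).card : ℝ) : ℝ) : EReal) + ((σ.network.eccent u : ENNReal) : EReal)

/-- The social cost: the sum of the costs of all players. -/
def socialCost [Fintype V] (α : ℝ) (σ : Profile V) : EReal :=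
  ∑ u, σ.cost α u

/-- The `k`-neighbourhood of `u`: the players at distance at most `k` from `u`. -/
def ball (σ : Profile V) (k : ℕ) (u : V) : Set V :=
  {v | σ.network.edist u v ≤ (k : ℕ∞)}

/-- The view of `u`: the subgraph of the network induced by her `k`-neighbourhood. -/
def view (σ : Profile V) (k : ℕ) (u : V) : SimpleGraph (σ.ball k u) :=
  σ.network.induce (σ.ball k u)

/-- A network that player `u`, who knows only `k`, her view and her own strategy in `σ`, holds
possible: a profile `τ` on some finite set of players (of any size) whose network is connected,
with a player `root` in the role of `u`, such that the view of `root` is a copy of the view of `u`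
and `root` buys the links that `u` buys. -/
structure RealizableNetwork (σ : Profile V) (k : ℕ) (u : V) where
  W : Type
  finite : Finite W
  τ : Profile W
  connected : τ.network.Connected
  root : W
  iso : σ.view k u ≃g τ.view k root
  iso_root : ∀ x, (iso x : W) = root ↔ (x : V) = u
  iso_bought : ∀ x, (iso x : W) ∈ τ.bought root ↔ (x : V) ∈ σ.bought u

namespace RealizableNetwork

variable {σ : Profile V} {k : ℕ} {u : V}

/-- A set of players in the view of `u`, read off in the realizable network `R`. -/
def transfer (R : RealizableNetwork σ k u) (T : Finset (σ.ball k u)) : Finset R.W :=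
  T.map (R.iso.toEquiv.toEmbedding.trans (Function.Embedding.subtype _))

theorem root_notMem_transfer (R : RealizableNetwork σ k u) {T : Finset (σ.ball k u)}
    (hT : ∀ x ∈ T, (x : V) ≠ u) : R.root ∉ R.transfer T := by
  intro h
  obtain ⟨x, hx, hxr⟩ := Finset.mem_map.1 h
  exact hT x hx ((R.iso_root x).1 hxr)

end RealizableNetwork

/-- The worst possible cost difference, over all realizable networks, that player `u` has in
switching from her strategy in `σ` to the subset `T` of her `k`-neighbourhood. -/
def worstDiff (α : ℝ) (k : ℕ) (σ : Profile V) (u : V) (T : Finset (σ.ball k u))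
    (hT : ∀ x ∈ T, (x : V) ≠ u) : EReal :=
  ⨆ R : RealizableNetwork σ k u,
    ((R.τ.deviate R.root (R.transfer T) (R.root_notMem_transfer hT)).cost α R.root
      - R.τ.cost α R.root)

/-- Local knowledge equilibria of MaxNCG (the players sit on a connected network). -/
def IsLKE (α : ℝ) (k : ℕ) (σ : Profile V) : Prop :=
  σ.network.Connected ∧
    ∀ (u : V) (T : Finset (σ.ball k u)) (hT : ∀ x ∈ T, (x : V) ≠ u), 0 ≤ worstDiff α k σ u T hT

end Profile

/-- The optimal social cost. -/
def optimalCost (α : ℝ) (V : Type) [Fintype V] : EReal :=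
  ⨅ σ : Profile V, σ.socialCost α

/-- The price of anarchy of local-knowledge MaxNCG: the largest ratio between the social cost of a
local knowledge equilibrium and the optimal social cost. -/
def priceOfAnarchy (α : ℝ) (k : ℕ) (V : Type) [Fintype V] : EReal :=
  ⨆ (σ : Profile V) (_ : σ.IsLKE α k), σ.socialCost α / optimalCost α V

end

noncomputable section

/-! ### Levels and branches around a vertex in a graph of large girth -/

namespace SimpleGraph

variable {V : Type} {G : SimpleGraph V}

/-! The worst case of a deviation is a supremum over realizable networks, so one network in which it
does not pay suffices. Take the view itself as the whole network (`ballRealizable`). If the girth is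
at least `2k+2`, the view of `u` is a tree of depth at most `k`, and her current cost is at most `α
b + k`, where `b` is the number of links she buys. With fewer than `b` links, some branch below a
bought link receives none and is cut off. With `b + j` links and `j + 2 ≤ k`, degrees of at least 3
make level `j + 2` larger than the number of links, so some branch at that level is missed, and its
vertices at depth `k` stay at distance at least `k - j`: at most `j` is gained, for a price `α j ≥
j`. Hence dense graphs of large girth are equilibria for every `α ≥ 1` (`isLKE_of_le_egirth`). Since
a star costs at most `3 α n`, the ratio to the optimum is at least the number of links divided by `3
n`.

It remains to find a `q`-regular graph of girth at least `2k+2` on at most `2 q ^ (2k-2)` vertices.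
Its edges are unitriangular matrices with `2k-1` free entries, its vertices the orbits of two groups
of elementary matrices of order `q`. A short closed walk without turning back is excluded by
following one row vector along its two halves: one half carries it to a coordinate that the other
cannot reach (`noShortClosed_orbitGraph`).

For general `n`, disjoint copies of such a graph and leftover isolated vertices are joined to a hub
by bridges, which create no cycle. -/

theorem Walk.IsPath.eq_of_length_add_lt_egirth {u v : V} {p q : G.Walk u v}
    (hp : p.IsPath) (hq : q.IsPath) (h : ((p.length + q.length : ℕ) : ℕ∞) < G.egirth) : p = q := by
  classical
  -- The edges of both paths together are too few for a cycle of `G`, and paths in an acyclic graph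
  -- are unique.
  set s : Set (Sym2 V) := {e | e ∈ p.edges ∨ e ∈ q.edges} with hs
  set H : SimpleGraph V := fromEdgeSet s with hH
  have hle : H ≤ G := by
    intro x y hxy
    rw [hH, fromEdgeSet_adj] at hxy
    rcases hxy.1 with h1 | h1
    · exact p.adj_of_mem_edges h1
    · exact q.adj_of_mem_edges h1
  have hmem : ∀ e ∈ G.edgeSet, e ∈ s → e ∈ H.edgeSet := by
    intro e he hes
    rw [hH, edgeSet_fromEdgeSet]
    exact ⟨hes, G.not_isDiag_of_mem_edgeSet he⟩
  have hac : H.IsAcyclic := by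
    intro a w hw
    have hw' : (w.mapLe hle).IsCycle := hw.mapLe hle
    have h1 : G.egirth ≤ (w.mapLe hle).length := egirth_le_length hw'
    have h2 : w.length ≤ p.length + q.length := by
      have h3 : w.edges.toFinset ⊆ p.edges.toFinset ∪ q.edges.toFinset := by
        intro e he
        have h4 := w.edges_subset_edgeSet (List.mem_toFinset.1 he)
        rw [hH, edgeSet_fromEdgeSet] at h4
        simpa [hs] using h4.1
      calc w.length = w.edges.toFinset.card := by
            rw [List.toFinset_card_of_nodup hw.edges_nodup, Walk.length_edges]
        _ ≤ _ := Finset.card_le_card h3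
        _ ≤ _ := Finset.card_union_le _ _
        _ ≤ p.edges.length + q.edges.length :=
            add_le_add (List.toFinset_card_le _) (List.toFinset_card_le _)
        _ = _ := by simp
    have h5 : (w.mapLe hle).length = w.length := by simp
    rw [h5] at h1
    exact absurd (lt_of_lt_of_le h h1) (not_lt.2 (by exact_mod_cast h2))
  have hpe : ∀ e ∈ p.edges, e ∈ H.edgeSet := fun e he =>
    hmem e (p.edges_subset_edgeSet he) (Or.inl he)
  have hqe : ∀ e ∈ q.edges, e ∈ H.edgeSet := fun e he =>
    hmem e (q.edges_subset_edgeSet he) (Or.inr he)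
  have h6 := (hac.subsingleton_path u v).elim ⟨p.transfer H hpe, hp.transfer hpe⟩
    ⟨q.transfer H hqe, hq.transfer hqe⟩
  have h7 : p.transfer H hpe = q.transfer H hqe := congrArg Subtype.val h6
  apply Walk.ext_support
  have := congrArg Walk.support h7
  simpa using this

section Levels

variable {k : ℕ} (hc : G.Connected) (hg : ((2 * k + 2 : ℕ) : ℕ∞) ≤ G.egirth)
include hc hg

theorem Connected.eq_of_adj_of_dist_succ {u z x y : V} (hz : G.dist u z ≤ k)
    (hx : G.Adj x z) (hy : G.Adj y z) (hdx : G.dist u x + 1 = G.dist u z)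
    (hdy : G.dist u y + 1 = G.dist u z) : x = y := by
  obtain ⟨p, hp⟩ := hc.exists_walk_length_eq_dist u x
  obtain ⟨q, hq⟩ := hc.exists_walk_length_eq_dist u y
  have hp' : (p.concat hx).IsPath := Walk.isPath_of_length_eq_dist _ (by simp [hp, hdx])
  have hq' : (q.concat hy).IsPath := Walk.isPath_of_length_eq_dist _ (by simp [hq, hdy])
  have := hp'.eq_of_length_add_lt_egirth hq' (lt_of_lt_of_le (by
    norm_cast; simp only [Walk.length_concat]; lia) hg)
  have h2 := congrArg Walk.penultimate this
  simpa using h2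

/-- Such an edge would give two paths from `u` to `y` of total length at most `2k + 1`, just below
the girth. -/
theorem Connected.not_adj_of_dist_eq {u x y : V} (hx : G.dist u x ≤ k)
    (h : G.dist u x = G.dist u y) : ¬ G.Adj x y := by
  classical
  intro hxy
  obtain ⟨p, hp⟩ := hc.exists_walk_length_eq_dist u x
  obtain ⟨q, hq⟩ := hc.exists_walk_length_eq_dist u y
  have hy : y ∉ p.support := by
    intro hy
    have h1 := G.dist_le (p.takeUntil y hy)
    have h2 : (p.takeUntil y hy).length + (p.dropUntil y hy).length = p.length := by
      rw [← Walk.length_append, Walk.take_spec]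
    have h3 : (p.dropUntil y hy).length = 0 := by lia
    exact hxy.ne (Walk.eq_of_length_eq_zero h3).symm
  have hp' : (p.concat hxy).IsPath := (p.isPath_of_length_eq_dist hp).concat hy hxy
  have := hp'.eq_of_length_add_lt_egirth (q.isPath_of_length_eq_dist hq) (lt_of_lt_of_le (by
    norm_cast; simp only [Walk.length_concat]; lia) hg)
  have h2 := congrArg Walk.length this
  simp at h2
  lia

end Levels

/-- The vertices `z` such that some shortest path from `u` to `z` passes through `y`. -/
def branch (G : SimpleGraph V) (u y : V) : Set V :=
  {z | G.dist u y + G.dist y z = G.dist u z}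

theorem mem_branch_self (u y : V) : y ∈ G.branch u y := by simp [branch]

theorem Connected.exists_adj_mem_branch (hc : G.Connected) {u y z : V} (hz : z ∈ G.branch u y)
    (hne : z ≠ y) : ∃ x, G.Adj x z ∧ x ∈ G.branch u y ∧ G.dist u x + 1 = G.dist u z := by
  obtain ⟨p, hp⟩ := hc.exists_walk_length_eq_dist y z
  have hnn : ¬ p.Nil := fun h => hne h.eq.symm
  have hz' : G.dist u y + G.dist y z = G.dist u z := hz
  have hadj := p.adj_penultimate hnn
  have h1 : G.dist y p.penultimate + 1 ≤ G.dist y z := by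
    have := G.dist_le p.dropLast
    have h2 : p.dropLast.length + 1 = p.length := p.length_dropLast_add_one hnn
    lia
  have h3 := hc.dist_triangle (u := u) (v := y) (w := p.penultimate)
  have h4 := hc.dist_triangle (u := u) (v := p.penultimate) (w := z)
  have h5 : G.dist p.penultimate z = 1 := dist_eq_one_iff_adj.2 hadj
  exact ⟨_, hadj, by change _ = _; lia, by lia⟩

section Levels

variable {k : ℕ} (hc : G.Connected) (hg : ((2 * k + 2 : ℕ) : ℕ∞) ≤ G.egirth)
include hc hg

/-- Parents are unique up to level `k`, so climbing from `z` meets each level in a single vertex. -/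
theorem Connected.eq_of_mem_branch {u y y' z : V} (hz : G.dist u z ≤ k)
    (hd : G.dist u y = G.dist u y') (h : z ∈ G.branch u y) (h' : z ∈ G.branch u y') : y = y' := by
  induction hn : G.dist u z generalizing z with
  | zero =>
    have h1 : G.dist u y + G.dist y z = G.dist u z := h
    have h2 : G.dist u y' + G.dist y' z = G.dist u z := h'
    rw [hc.dist_eq_zero_iff.1 (show G.dist y z = 0 by lia),
      hc.dist_eq_zero_iff.1 (show G.dist y' z = 0 by lia)]
  | succ n ih =>
    have h1 : G.dist u y + G.dist y z = G.dist u z := h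
    have h2 : G.dist u y' + G.dist y' z = G.dist u z := h'
    by_cases hy : z = y
    · subst hy
      exact (hc.dist_eq_zero_iff.1 (show G.dist y' z = 0 by simp at h1; lia)).symm
    by_cases hy' : z = y'
    · subst hy'
      exact (hc.dist_eq_zero_iff.1 (show G.dist y z = 0 by simp at h2; lia))
    obtain ⟨x, hx, hxb, hxd⟩ := hc.exists_adj_mem_branch h hy
    obtain ⟨x', hx', hxb', hxd'⟩ := hc.exists_adj_mem_branch h' hy'
    have : x = x' := hc.eq_of_adj_of_dist_succ hg hz hx hx' hxd hxd'
    subst this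
    exact ih (by lia) hxb hxb' (by lia)

/-- An edge leaving a branch within distance `k` of the root is the edge above its top vertex. -/
theorem Connected.eq_of_adj_branch {u y z x : V} (hz : G.dist u z ≤ k) (hx : G.dist u x ≤ k)
    (hzx : G.Adj z x) (h : z ∈ G.branch u y) (h' : x ∉ G.branch u y) :
    z = y ∧ G.dist u x + 1 = G.dist u y := by
  have h1 : G.dist u y + G.dist y z = G.dist u z := h
  have h2 : G.dist z x = 1 := dist_eq_one_iff_adj.2 hzx
  have h3 := hc.dist_triangle (u := u) (v := z) (w := x)
  have h4 := hc.dist_triangle (u := u) (v := x) (w := z)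
  have h5 := hc.dist_triangle (u := y) (v := z) (w := x)
  have h6 := hc.dist_triangle (u := u) (v := y) (w := x)
  have h7 : G.dist x z = 1 := dist_eq_one_iff_adj.2 hzx.symm
  have h8 : G.dist u z ≠ G.dist u x := fun he => hc.not_adj_of_dist_eq hg hz he hzx
  have h9 : G.dist u y + G.dist y x ≠ G.dist u x := h'
  have h10 : G.dist u x + 1 = G.dist u z := by lia
  by_cases hy : z = y
  · subst hy
    exact ⟨rfl, h10⟩
  · obtain ⟨w, hw, hwb, hwd⟩ := hc.exists_adj_mem_branch h hy
    have := hc.eq_of_adj_of_dist_succ hg hz hw hzx.symm hwd h10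
    subst this
    exact absurd hwb h'

end Levels

/-- Potentials certify large distances after a deviation; potentials of arbitrary height certify
disconnection. -/
theorem natCast_le_edist_of_forall_adj {u v : V} (φ : V → ℕ) (h0 : φ u = 0)
    (h : ∀ x y, G.Adj x y → φ y ≤ φ x + 1) : (φ v : ℕ∞) ≤ G.edist u v := by
  have key : ∀ {a b : V} (p : G.Walk a b), φ b ≤ φ a + p.length := by
    intro a b p
    induction p with
    | nil => simp
    | cons hab p ih => have := h _ _ hab; simp only [Walk.length_cons]; lia
  refine le_iInf fun p => ?_
  have := key p
  exact_mod_cast (by lia : φ v ≤ p.length)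

end SimpleGraph

/-! ### Growth of the levels -/

namespace SimpleGraph

variable {V : Type} {G : SimpleGraph V}

section Expansion

variable [Fintype V] {k : ℕ} {S : Finset V} (hc : G.Connected)
  (hg : ((2 * k + 2 : ℕ) : ℕ∞) ≤ G.egirth)
include hc hg

-- Of the three neighbours in `S`, at most one is the parent of `y` and none lies on the level of
-- `y`.
open Classical in
theorem Connected.two_le_card_children (hS : ∀ v ∈ S, 3 ≤ {x ∈ S | G.Adj v x}.card)
    {u y : V} (hy : y ∈ S) (hd : G.dist u y ≤ k) :
    2 ≤ {x ∈ S | G.Adj y x ∧ G.dist u x = G.dist u y + 1}.card := by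
  set P : Finset V := {x | G.Adj x y ∧ G.dist u x + 1 = G.dist u y} with hP
  have hP1 : P.card ≤ 1 := by
    refine Finset.card_le_one.2 fun a ha b hb => ?_
    simp only [hP, Finset.mem_filter, Finset.mem_univ, true_and] at ha hb
    exact hc.eq_of_adj_of_dist_succ hg hd ha.1 hb.1 ha.2 hb.2
  have hsub : {x ∈ S | G.Adj y x} ⊆
      {x ∈ S | G.Adj y x ∧ G.dist u x = G.dist u y + 1} ∪ P := by
    intro x hx
    simp only [hP, Finset.mem_union, Finset.mem_filter, Finset.mem_univ, true_and] at hx ⊢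
    have h1 := hc.dist_triangle (u := u) (v := y) (w := x)
    have h2 := hc.dist_triangle (u := u) (v := x) (w := y)
    have h3 : G.dist y x = 1 := dist_eq_one_iff_adj.2 hx.2
    have h4 : G.dist x y = 1 := dist_eq_one_iff_adj.2 hx.2.symm
    have h5 : G.dist u y ≠ G.dist u x := fun he => hc.not_adj_of_dist_eq hg hd he hx.2
    rcases (by lia : G.dist u x = G.dist u y + 1 ∨ G.dist u x + 1 = G.dist u y) with h | h
    · exact Or.inl ⟨hx.1, hx.2, h⟩
    · exact Or.inr ⟨hx.2.symm, h⟩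
  have := (Finset.card_le_card hsub).trans (Finset.card_union_le _ _)
  have := hS y hy
  lia

-- Double counting: at least two children, at most one parent.
open Classical in
theorem Connected.two_mul_card_level_le (hS : ∀ v ∈ S, 3 ≤ {x ∈ S | G.Adj v x}.card)
    {u : V} {i : ℕ} (hi : i + 1 ≤ k) :
    2 * {x ∈ S | G.dist u x = i}.card ≤ {x ∈ S | G.dist u x = i + 1}.card := by
  have := Finset.card_mul_le_card_mul (s := {x ∈ S | G.dist u x = i})
    (t := {x ∈ S | G.dist u x = i + 1}) (m := 2) (n := 1) G.Adj ?_ ?_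
  · lia
  · intro y hy
    rw [Finset.mem_filter] at hy
    refine (hc.two_le_card_children hg hS (u := u) hy.1 (by lia)).trans (Finset.card_le_card ?_)
    intro x hx
    rw [Finset.mem_filter] at hx
    rw [Finset.mem_bipartiteAbove, Finset.mem_filter]
    exact ⟨⟨hx.1, by lia⟩, hx.2.1⟩
  · intro x hx
    rw [Finset.mem_filter] at hx
    refine Finset.card_le_one.2 fun a ha b hb => ?_
    rw [Finset.mem_bipartiteBelow, Finset.mem_filter] at ha hb
    exact hc.eq_of_adj_of_dist_succ hg (u := u) (z := x) (by lia) ha.2 hb.2 (by lia) (by lia)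

open Classical in
theorem Connected.card_level_one_mul_le (hS : ∀ v ∈ S, 3 ≤ {x ∈ S | G.Adj v x}.card)
    {u : V} {i : ℕ} (hi : i + 1 ≤ k) :
    {x ∈ S | G.Adj u x}.card * 2 ^ i ≤ {x ∈ S | G.dist u x = i + 1}.card := by
  induction i with
  | zero => simp [dist_eq_one_iff_adj]
  | succ i ih =>
    have h1 := ih (by lia)
    have h2 := hc.two_mul_card_level_le hg hS (u := u) (i := i + 1) hi
    rw [pow_succ]
    lia

open Classical in
theorem Connected.exists_mem_branch_dist_eq (hS : ∀ v ∈ S, 3 ≤ {x ∈ S | G.Adj v x}.card)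
    {u y : V} (hy : y ∈ S) (hd : G.dist u y ≤ k) :
    ∃ x ∈ G.branch u y, G.dist u x = k := by
  have key : ∀ i, G.dist u y + i ≤ k → ∃ x ∈ S, x ∈ G.branch u y ∧ G.dist u x = G.dist u y + i := by
    intro i
    induction i with
    | zero => exact fun _ => ⟨y, hy, mem_branch_self u y, rfl⟩
    | succ i ih =>
      intro hi
      obtain ⟨x, hx, hxb, hxd⟩ := ih (by lia)
      obtain ⟨z, hz⟩ := Finset.card_pos.1
        (lt_of_lt_of_le two_pos (hc.two_le_card_children hg hS (u := u) hx (by lia)))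
      rw [Finset.mem_filter] at hz
      refine ⟨z, hz.1, ?_, by lia⟩
      by_contra hzb
      have := hc.eq_of_adj_branch hg (by lia) (by lia) hz.2.1 hxb hzb
      have := this.2
      lia
  obtain ⟨x, -, hxb, hxd⟩ := key (k - G.dist u y) (by lia)
  exact ⟨x, hxb, by lia⟩

omit [Fintype V] in
/-- Fewer vertices than a set `D` of vertices on one level miss one of the branches at `D`. -/
theorem Connected.exists_forall_notMem_branch {u : V} {d : ℕ} {D T : Finset V}
    (hD : ∀ y ∈ D, G.dist u y = d) (hT : ∀ x ∈ T, G.dist u x ≤ k) (h : T.card < D.card) :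
    ∃ y ∈ D, ∀ x ∈ T, x ∉ G.branch u y := by
  -- Branches at one level are disjoint, so choosing a vertex of `T` in each of them is injective.
  by_contra! hcon
  choose! f hf using hcon
  refine absurd (Finset.card_le_card_of_injOn f (fun y hy => (hf y hy).1) ?_) (not_le.2 h)
  intro a ha b hb hab
  have h1 := (hf a ha).2
  have h2 := (hf b hb).2
  rw [← hab] at h2
  exact hc.eq_of_mem_branch hg (hT _ (hf a ha).1) ((hD a ha).trans (hD b hb).symm) h1 h2

end Expansion

end SimpleGraph

/-! ### The view as a realizable network -/

namespace Profile

variable {V : Type}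

open SimpleGraph

theorem mem_ball_iff {σ : Profile V} (hc : σ.network.Connected) {k : ℕ} {u v : V} :
    v ∈ σ.ball k u ↔ σ.network.dist u v ≤ k := by
  change σ.network.edist u v ≤ k ↔ _
  rw [← (hc u v).coe_dist_eq_edist]
  norm_cast

theorem self_mem_ball (σ : Profile V) (k : ℕ) (u : V) : u ∈ σ.ball k u := by
  change σ.network.edist u u ≤ k
  simp

open Classical in
/-- The profile that the players of the `k`-neighbourhood of `u` play among themselves. -/
def ballProfile (σ : Profile V) (k : ℕ) (u : V) : Profile (σ.ball k u) where
  bought x := (σ.bought x).subtype (· ∈ σ.ball k u)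
  irrefl x h := σ.irrefl x (Finset.mem_subtype.1 h)

theorem ballProfile_adj {σ : Profile V} {k : ℕ} {u : V} {x y : σ.ball k u} :
    (σ.ballProfile k u).network.Adj x y ↔ σ.network.Adj x y := by
  simp [network, ballProfile]

/-- Shortest paths from `u` to vertices of the ball stay in the ball. -/
theorem edist_ballProfile_le {σ : Profile V} (hc : σ.network.Connected) {k : ℕ} {u : V}
    (z : σ.ball k u) :
    (σ.ballProfile k u).network.edist ⟨u, σ.self_mem_ball k u⟩ z ≤ k := by
  have key : ∀ n : ℕ, ∀ z : σ.ball k u, σ.network.dist u z = n →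
      (σ.ballProfile k u).network.edist ⟨u, σ.self_mem_ball k u⟩ z ≤ n := by
    intro n
    induction n with
    | zero =>
      intro z hz
      have : u = z := hc.dist_eq_zero_iff.1 hz
      simp [this]
    | succ n ih =>
      intro z hz
      have hne : (z : V) ≠ u := by
        intro h
        rw [h] at hz
        simp at hz
      obtain ⟨x, hx, -, hd⟩ := hc.exists_adj_mem_branch (u := u) (y := u) (z := z)
        (by simp [branch]) hne
      have hzk := (mem_ball_iff hc).1 z.2
      let x' : σ.ball k u := ⟨x, (mem_ball_iff hc).2 (by lia)⟩
      have h1 : (σ.ballProfile k u).network.edist x' z = 1 :=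
        edist_eq_one_iff_adj.2 (ballProfile_adj.2 hx)
      refine (SimpleGraph.edist_triangle (v := x')).trans ?_
      rw [h1]
      push_cast
      gcongr
      exact ih x' (by change σ.network.dist u x = n; lia)
  refine (key _ z rfl).trans ?_
  exact_mod_cast (mem_ball_iff hc).1 z.2

/-- The `k`-neighbourhood of `u`, taken for the whole network, is realizable. -/
def ballRealizable [Finite V] (σ : Profile V) (hc : σ.network.Connected) (k : ℕ) (u : V) :
    RealizableNetwork σ k u where
  W := σ.ball k u
  finite := inferInstance
  τ := σ.ballProfile k u
  connected :=
    (connected_iff_exists_forall_reachable _).2 ⟨⟨u, σ.self_mem_ball k u⟩, fun z =>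
      reachable_of_edist_ne_top
        (ne_top_of_le_ne_top (ENat.natCast_ne_top k) (edist_ballProfile_le hc z))⟩
  root := ⟨u, σ.self_mem_ball k u⟩
  iso :=
    { toFun := fun x => ⟨x, edist_ballProfile_le hc x⟩
      invFun := fun x => x.1
      left_inv := fun _ => rfl
      right_inv := fun _ => rfl
      map_rel_iff' := ballProfile_adj }
  iso_root x := Subtype.ext_iff
  iso_bought x := by
    change x ∈ (σ.ballProfile k u).bought _ ↔ _
    simp [ballProfile]

theorem ballRealizable_transfer [Finite V] (σ : Profile V) (hc : σ.network.Connected) (k : ℕ)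
    (u : V) (T : Finset (σ.ball k u)) : (σ.ballRealizable hc k u).transfer T = T := by
  ext x
  simp only [RealizableNetwork.transfer, Finset.mem_map]
  constructor
  · rintro ⟨y, hy, rfl⟩
    exact hy
  · intro hx
    exact ⟨x, hx, rfl⟩

theorem deviate_adj {σ : Profile V} {u : V} {T : Finset V} {hT : u ∉ T} {x y : V}
    (h : (σ.deviate u T hT).network.Adj x y) :
    (x = u ∧ y ∈ T) ∨ (y = u ∧ x ∈ T) ∨ (x ≠ u ∧ y ∈ σ.bought x) ∨ (y ≠ u ∧ x ∈ σ.bought y) := by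
  rcases h with h | h
  · by_cases hx : x = u
    · subst hx
      exact Or.inl ⟨rfl, by simpa [deviate] using h⟩
    · exact Or.inr (Or.inr (Or.inl ⟨hx, by simpa [deviate, hx] using h⟩))
  · by_cases hy : y = u
    · subst hy
      exact Or.inr (Or.inl ⟨rfl, by simpa [deviate] using h⟩)
    · exact Or.inr (Or.inr (Or.inr ⟨hy, by simpa [deviate, hy] using h⟩))

end Profile

/-! ### Large girth implies equilibrium -/

namespace Profile

variable {V : Type}

open SimpleGraph

theorem coe_natCast_enat (m : ℕ) :
    ((((m : ℕ∞) : ENNReal) : EReal)) = ((m : ℝ) : EReal) := by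
  rw [ENat.toENNReal_coe, ← ENNReal.ofReal_natCast,
    EReal.coe_ennreal_ofReal, max_eq_left (Nat.cast_nonneg m)]

theorem coe_add_natCast_le_cost {α : ℝ} {σ : Profile V} {u : V} {m : ℕ}
    (h : (m : ℕ∞) ≤ σ.network.eccent u) :
    ((α * ((σ.bought u).card : ℝ) + m : ℝ) : EReal) ≤ σ.cost α u := by
  rw [cost, EReal.coe_add]
  gcongr
  rw [← coe_natCast_enat, EReal.coe_ennreal_le_coe_ennreal_iff]
  exact ENat.toENNReal_le.2 h

theorem cost_le_coe_add_natCast {α : ℝ} {σ : Profile V} {u : V} {m : ℕ}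
    (h : σ.network.eccent u ≤ m) :
    σ.cost α u ≤ ((α * ((σ.bought u).card : ℝ) + m : ℝ) : EReal) := by
  rw [cost, EReal.coe_add]
  gcongr
  rw [← coe_natCast_enat, EReal.coe_ennreal_le_coe_ennreal_iff]
  exact ENat.toENNReal_le.2 h

section Equilibrium

variable [Fintype V] {k : ℕ} {σ : Profile V} (hc : σ.network.Connected)
  (hg : ((2 * k + 2 : ℕ) : ℕ∞) ≤ σ.network.egirth) (hk : 1 ≤ k) {u : V}
  {T : Finset (σ.ball k u)} (hT : (⟨u, σ.self_mem_ball k u⟩ : σ.ball k u) ∉ T)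
include hc hg hk

omit [Fintype V] in
/-- If the new links are fewer than the links bought in `σ`, they leave out one of the branches
below the links bought in `σ`, which gets disconnected from `u`. -/
theorem eccent_deviate_ballProfile_eq_top (hone : ∀ x y, y ∈ σ.bought x → x ∉ σ.bought y)
    (h : T.card < (σ.bought u).card) :
    ((σ.ballProfile k u).deviate ⟨u, σ.self_mem_ball k u⟩ T hT).network.eccent
      ⟨u, σ.self_mem_ball k u⟩ = ⊤ := by
  obtain ⟨y, hy, hyT⟩ := hc.exists_forall_notMem_branch hg (u := u) (d := 1) (D := σ.bought u)
    (T := T.map (Function.Embedding.subtype _))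
    (fun y hy => dist_eq_one_iff_adj.2 (Or.inl hy))
    (by
      intro x hx
      obtain ⟨x, -, rfl⟩ := Finset.mem_map.1 hx
      exact (mem_ball_iff hc).1 x.2) (by simpa using h)
  have hyT' : ∀ x ∈ T, (x : V) ∉ σ.network.branch u y := fun x hx =>
    hyT x (Finset.mem_map_of_mem (Function.Embedding.subtype _) hx)
  have hd : σ.network.dist u y = 1 := dist_eq_one_iff_adj.2 (Or.inl hy)
  have huy : u ∉ σ.network.branch u y := by
    simp [branch, hd]
  have hcross : ∀ x z : σ.ball k u, z ∈ (σ.ballProfile k u).bought x ∧ (x : V) ≠ u →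
      ((x : V) ∈ σ.network.branch u y ↔ (z : V) ∈ σ.network.branch u y) := by
    rintro x z ⟨hz, hx⟩
    have hz' : (z : V) ∈ σ.bought x := by simpa [ballProfile] using hz
    have hxk := (mem_ball_iff hc).1 x.2
    have hzk := (mem_ball_iff hc).1 z.2
    by_contra hne
    rcases (by tauto : ((x : V) ∈ σ.network.branch u y ∧ (z : V) ∉ σ.network.branch u y) ∨
      ((z : V) ∈ σ.network.branch u y ∧ (x : V) ∉ σ.network.branch u y)) with ⟨h1, h2⟩ | ⟨h1, h2⟩
    -- The only edge leaving the branch joins `y` to `u`; it is bought by `u`, hence not by `y`, and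
    -- goes away with the old strategy.
    · have h3 := hc.eq_of_adj_branch hg hxk hzk (Or.inl hz') h1 h2
      have h4 : u = z := hc.dist_eq_zero_iff.1 (by lia)
      rw [h3.1, ← h4] at hz'
      exact hone _ _ hy hz'
    · have h3 := hc.eq_of_adj_branch hg hzk hxk (Or.inr hz') h1 h2
      exact hx (hc.dist_eq_zero_iff.1 (by lia)).symm
  classical
  have hy0 : y ∈ σ.ball k u := (mem_ball_iff hc).2 (by lia)
  rw [ENat.eq_top_iff_forall_ge]
  intro m
  refine le_trans ?_ (edist_le_eccent (v := ⟨y, hy0⟩))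
  -- No edge crosses the border of the branch, so a potential may jump there by any `m`.
  have := natCast_le_edist_of_forall_adj
    (G := ((σ.ballProfile k u).deviate ⟨u, σ.self_mem_ball k u⟩ T hT).network)
    (u := ⟨u, σ.self_mem_ball k u⟩) (v := ⟨y, hy0⟩)
    (fun x => if (x : V) ∈ σ.network.branch u y then m else 0) (by simp [huy]) ?_
  · simpa [mem_branch_self] using this
  · intro x z hxz
    have : ((x : V) ∈ σ.network.branch u y ↔ (z : V) ∈ σ.network.branch u y) := by
      rcases deviate_adj hxz with ⟨rfl, h1⟩ | ⟨rfl, h1⟩ | ⟨h1, h2⟩ | ⟨h1, h2⟩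
      · have := hyT' _ h1
        tauto
      · have := hyT' _ h1
        tauto
      · exact hcross x z ⟨h2, fun h => h1 (Subtype.ext h)⟩
      · exact (hcross z x ⟨h2, fun h => h1 (Subtype.ext h)⟩).symm
    simp only [this]
    lia

open Classical in
/-- With `j` more links than in `σ`, the eccentricity of `u` drops by at most `j`. -/
theorem le_eccent_deviate_ballProfile {S : Finset V}
    (hS : ∀ v ∈ S, 3 ≤ {x ∈ S | σ.network.Adj v x}.card)
    (hb : σ.bought u ⊆ S) (hn : ∃ v ∈ S, σ.network.Adj u v) {j : ℕ}
    (h : T.card = (σ.bought u).card + j) :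
    ((k - j : ℕ) : ℕ∞) ≤ ((σ.ballProfile k u).deviate ⟨u, σ.self_mem_ball k u⟩ T hT).network.eccent
      ⟨u, σ.self_mem_ball k u⟩ := by
  obtain ⟨v, hv, huv⟩ := hn
  by_cases hj : j + 2 ≤ k
  swap
  -- Here `k - j ≤ 1`, and the eccentricity is nonzero because there are two vertices.
  · have : Nontrivial (σ.ball k u) :=
      ⟨⟨u, σ.self_mem_ball k u⟩, ⟨v, (mem_ball_iff hc).2 (by
        rw [dist_eq_one_iff_adj.2 huv]; exact hk)⟩, fun he => huv.ne (congrArg Subtype.val he)⟩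
    refine le_trans ?_ (Order.one_le_iff_ne_zero.2 (eccent_ne_zero _))
    exact_mod_cast (by lia : k - j ≤ 1)
  have hlevel := hc.card_level_one_mul_le hg hS (u := u) (i := j + 1) hj
  have h1 : (σ.bought u).card ≤ {x ∈ S | σ.network.Adj u x}.card :=
    Finset.card_le_card fun x hx => Finset.mem_filter.2 ⟨hb hx, Or.inl hx⟩
  have h2 : 1 ≤ {x ∈ S | σ.network.Adj u x}.card :=
    Finset.card_pos.2 ⟨v, Finset.mem_filter.2 ⟨hv, huv⟩⟩
  -- With `D ≥ 1` neighbours of `u` in `S`: `|T| ≤ D + j < D (j + 2) ≤ D 2 ^ (j + 1)`.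
  have h3 : j + 2 ≤ 2 ^ (j + 1) := Nat.lt_two_pow_self
  have h4 : T.card < {x ∈ S | σ.network.dist u x = j + 1 + 1}.card := by
    refine lt_of_lt_of_le ?_ hlevel
    have := Nat.mul_le_mul_left ({x ∈ S | σ.network.Adj u x}.card) h3
    have := Nat.mul_le_mul_right j h2
    rw [h]
    lia
  obtain ⟨y, hy, hyT⟩ := hc.exists_forall_notMem_branch hg (u := u) (d := j + 2)
    (D := {x ∈ S | σ.network.dist u x = j + 1 + 1})
    (T := T.map (Function.Embedding.subtype _))
    (fun y hy => (Finset.mem_filter.1 hy).2)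
    (by
      intro x hx
      obtain ⟨x, -, rfl⟩ := Finset.mem_map.1 hx
      exact (mem_ball_iff hc).1 x.2) (by simpa using h4)
  have hyT' : ∀ x ∈ T, (x : V) ∉ σ.network.branch u y := fun x hx =>
    hyT x (Finset.mem_map_of_mem (Function.Embedding.subtype _) hx)
  rw [Finset.mem_filter] at hy
  obtain ⟨hyS, hd⟩ := hy
  obtain ⟨x, hxb, hxk⟩ := hc.exists_mem_branch_dist_eq hg hS (u := u) hyS (by lia)
  have huy : u ∉ σ.network.branch u y := by
    simp [branch, hd]
  have hx0 : x ∈ σ.ball k u := (mem_ball_iff hc).2 hxk.le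
  refine le_trans ?_ (edist_le_eccent (v := ⟨x, hx0⟩))
  -- The branch is entered only from the parent of `y`, which is not `u` since `y` is on level `j +
  -- 2`. So `y` is at least two steps away from `u`.
  set φ : σ.ball k u → ℕ := fun z =>
    if (z : V) ∈ σ.network.branch u y then σ.network.dist y z + 2
    else if (z : V) = u then 0 else 1 with hφ
  have hφu : φ ⟨u, σ.self_mem_ball k u⟩ = 0 := by simp [hφ, huy]
  have hφT : ∀ z ∈ T, φ z ≤ 1 := by
    intro z hz
    simp only [hφ, if_neg (hyT' z hz)]
    split <;> lia
  have hφG : ∀ w z : σ.ball k u, σ.network.Adj w z → φ z ≤ φ w + 1 := by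
    intro w z hwz
    have hwk := (mem_ball_iff hc).1 w.2
    have hzk := (mem_ball_iff hc).1 z.2
    simp only [hφ]
    by_cases hw : (w : V) ∈ σ.network.branch u y
    · have h6 := hc.dist_triangle (u := y) (v := (w : V)) (w := (z : V))
      have h7 : σ.network.dist (w : V) z = 1 := dist_eq_one_iff_adj.2 hwz
      simp only [if_pos hw]
      split_ifs <;> lia
    · by_cases hz : (z : V) ∈ σ.network.branch u y
      · obtain ⟨h6, h7⟩ := hc.eq_of_adj_branch hg hzk hwk hwz.symm hz hw
        have hwu : (w : V) ≠ u := by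
          intro he
          rw [he] at h7
          simp [hd] at h7
        simp [hw, hwu, h6, mem_branch_self]
      · simp only [if_neg hz, if_neg hw]
        split_ifs <;> lia
  have := natCast_le_edist_of_forall_adj
    (G := ((σ.ballProfile k u).deviate ⟨u, σ.self_mem_ball k u⟩ T hT).network)
    (u := ⟨u, σ.self_mem_ball k u⟩) (v := ⟨x, hx0⟩) φ hφu ?_
  · refine le_trans ?_ this
    have h6 : σ.network.dist u y + σ.network.dist y x = σ.network.dist u x := hxb
    simp only [hφ, if_pos hxb]
    exact_mod_cast (by lia : k - j ≤ σ.network.dist y x + 2)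
  · intro w z hwz
    rcases deviate_adj hwz with ⟨rfl, h1⟩ | ⟨rfl, h1⟩ | ⟨h1, h2⟩ | ⟨h1, h2⟩
    · have := hφT z h1
      lia
    · lia
    · exact hφG w z (Or.inl (by simpa [ballProfile] using h2))
    · exact hφG w z (Or.inr (by simpa [ballProfile] using h2))

end Equilibrium

-- The degree condition is confined to a core `S`, so that pendant vertices are allowed outside it.
-- All bought links end in `S`, so their number is bounded by the number of neighbours in `S`.
open Classical in
theorem isLKE_of_le_egirth [Fintype V] {k : ℕ} (hk : 1 ≤ k) {σ : Profile V}
    (hc : σ.network.Connected) (hg : ((2 * k + 2 : ℕ) : ℕ∞) ≤ σ.network.egirth)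
    (hone : ∀ x y, y ∈ σ.bought x → x ∉ σ.bought y) {S : Finset V}
    (hS : ∀ v ∈ S, 3 ≤ {x ∈ S | σ.network.Adj v x}.card) (hb : ∀ u, σ.bought u ⊆ S)
    (hn : ∀ u, ∃ v ∈ S, σ.network.Adj u v) {α : ℝ} (hα : 1 ≤ α) : σ.IsLKE α k := by
  refine ⟨hc, fun u T hT => ?_⟩
  refine le_trans ?_ (le_iSup _ (σ.ballRealizable hc k u))
  set root : σ.ball k u := ⟨u, σ.self_mem_ball k u⟩ with hroot
  have hT' : root ∉ T := fun h => hT _ h rfl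
  have hbb : ((σ.ballProfile k u).bought root).card = (σ.bought u).card := by
    change ((σ.bought u).subtype _).card = _
    rw [Finset.card_subtype, Finset.filter_true_of_mem]
    intro x hx
    refine (mem_ball_iff hc).2 ?_
    rw [dist_eq_one_iff_adj.2 (Or.inl hx)]
    exact hk
  have hold : (σ.ballProfile k u).cost α root ≤ ((α * ((σ.bought u).card : ℝ) + k : ℝ) : EReal) := by
    rw [← hbb]
    exact cost_le_coe_add_natCast ((eccent_le_iff _ _).2 fun z => edist_ballProfile_le hc z)
  have hmain : ((α * ((σ.bought u).card : ℝ) + k : ℝ) : EReal) ≤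
      ((σ.ballProfile k u).deviate root T hT').cost α root := by
    have hTb : (((σ.ballProfile k u).deviate root T hT').bought root) = T := by
      simp [deviate]
    by_cases hlt : T.card < (σ.bought u).card
    · rw [cost, eccent_deviate_ballProfile_eq_top hc hg hk hT' hone hlt]
      rw [ENat.toENNReal_top, EReal.coe_ennreal_top, EReal.coe_add_top]
      exact le_top
    · obtain ⟨j, hj⟩ := Nat.exists_eq_add_of_le (not_lt.1 hlt)
      refine le_trans ?_ (coe_add_natCast_le_cost
        (le_eccent_deviate_ballProfile hc hg hk hT' hS (hb u) (hn u) hj))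
      rw [hTb, hj, EReal.coe_le_coe_iff]
      have h1 : (k : ℝ) ≤ ((k - j : ℕ) : ℝ) + j := by exact_mod_cast (by lia : k ≤ k - j + j)
      have h2 : (j : ℝ) ≤ α * j := le_mul_of_one_le_left (Nat.cast_nonneg j) hα
      push_cast
      linarith
  have hfin := hold.trans hmain
  have heq : ((σ.ballRealizable hc k u).τ.deviate (σ.ballRealizable hc k u).root
      ((σ.ballRealizable hc k u).transfer T)
      ((σ.ballRealizable hc k u).root_notMem_transfer hT)) =
      (σ.ballProfile k u).deviate root T hT' := by
    congr 1
    exact ballRealizable_transfer σ hc k u T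
  rw [heq]
  -- In `EReal`, comparing the difference with zero requires the old cost to be finite.
  refine (EReal.sub_nonneg (Or.inr ?_) (Or.inr ?_)).2 hfin
  · exact ne_top_of_le_ne_top (EReal.coe_ne_top _) hold
  · refine ne_bot_of_le_ne_bot (EReal.coe_ne_bot _) (coe_add_natCast_le_cost (m := 0) ?_)
    simp

end Profile

/-! ### Girth through closed walks that never turn back -/

namespace SimpleGraph

variable {V W : Type}

/-- There is no closed sequence of at most `m` steps along the edges which never turns back. -/
def NoShortClosed (G : SimpleGraph V) (m : ℕ) : Prop :=
  ∀ (l : ℕ) (f : ℕ → V), 1 ≤ l → l ≤ m → (∀ i, f (i + l) = f i) →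
    (∀ i, G.Adj (f i) (f (i + 1))) → ∃ i, f i = f (i + 2)

theorem NoShortClosed.le_egirth {G : SimpleGraph V} {m : ℕ} (h : G.NoShortClosed m) :
    ((m + 1 : ℕ) : ℕ∞) ≤ G.egirth := by
  rw [SimpleGraph.le_egirth]
  intro a w hw
  by_contra hlt
  have hlt' : w.length ≤ m := by
    have : w.length < m + 1 := by exact_mod_cast not_le.1 hlt
    lia
  have h3 := hw.three_le_length
  obtain ⟨i, hi⟩ := h w.length (fun i => w.getVert (i % w.length)) (by lia) hlt'
    (fun i => by simp) (fun i => by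
      have h4 : i % w.length < w.length := Nat.mod_lt _ (by lia)
      have h5 := w.adj_getVert_succ h4
      have h6 : (i + 1) % w.length = if i % w.length + 1 = w.length then 0 else i % w.length + 1 := by
        rw [Nat.add_mod_eq_ite, Nat.mod_eq_of_lt (by lia : 1 < w.length)]
        split_ifs <;> lia
      simp only [h6]
      split_ifs with h7
      · rw [h7, Walk.getVert_length] at h5
        simpa using h5
      · exact h5)
  have h4 : i % w.length < w.length := Nat.mod_lt _ (by lia)
  have h5 : (i + 2) % w.length < w.length := Nat.mod_lt _ (by lia)
  have h6 := hw.getVert_injOn' (by simp only [Set.mem_ofPred_eq]; lia)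
    (by simp only [Set.mem_ofPred_eq]; lia) hi
  rw [Nat.add_mod_eq_ite, Nat.mod_eq_of_lt (by lia : 2 < w.length)] at h6
  split_ifs at h6 <;> lia

/-- The image of a cycle under a locally injective homomorphism need not be a cycle, but it still
never turns back. This is why the condition is phrased with sequences. -/
theorem NoShortClosed.of_map {G : SimpleGraph V} {H : SimpleGraph W} {m : ℕ}
    (h : H.NoShortClosed m) (f : V → W) (hf : ∀ x y, G.Adj x y → H.Adj (f x) (f y))
    (hinj : ∀ x y z, G.Adj y x → G.Adj y z → f x = f z → x = z) : G.NoShortClosed m := by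
  intro l g h1 hl hper hadj
  obtain ⟨i, hi⟩ := h l (f ∘ g) h1 hl (fun i => congrArg f (hper i)) (fun i => hf _ _ (hadj i))
  exact ⟨i, hinj _ (g (i + 1)) _ (hadj i).symm (hadj (i + 1)) hi⟩

/-- Bridges lie on no cycle, so every cycle of `H` is one of `G`. -/
theorem egirth_le_egirth_of_isBridge {G H : SimpleGraph V}
    (h : ∀ x y, H.Adj x y → ¬ G.Adj x y → H.IsBridge s(x, y)) : G.egirth ≤ H.egirth := by
  rw [SimpleGraph.le_egirth]
  intro a w hw
  have hmem : ∀ e ∈ w.edges, e ∈ G.edgeSet := by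
    intro e he
    induction e with
    | _ x y =>
      have hxy : H.Adj x y := w.adj_of_mem_edges he
      by_contra hn
      exact (isBridge_iff_forall_cycle_notMem hxy).1 (h x y hxy hn) w hw he
  have := egirth_le_length (hw.transfer hmem)
  simpa using this

end SimpleGraph

/-! ### Joining components to a hub; disjoint copies -/

namespace SimpleGraph

section HubJoin

variable {V : Type}

/-- `y` is the chosen representative of a connected component other than that of `h`. -/
def IsForeignRep (G : SimpleGraph V) (h y : V) : Prop :=
  G.connectedComponentMk y ≠ G.connectedComponentMk h ∧ (G.connectedComponentMk y).out = y

/-- The graph `G` with an edge from `h` to a representative of each other connected component. -/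
def hubJoin (G : SimpleGraph V) (h : V) : SimpleGraph V where
  Adj x y := G.Adj x y ∨ (x = h ∧ G.IsForeignRep h y) ∨ (y = h ∧ G.IsForeignRep h x)
  symm := ⟨fun _ _ hxy => hxy.imp (fun h => h.symm) Or.symm⟩
  loopless := ⟨fun x hx => by
    rcases hx with hx | ⟨rfl, hx⟩ | ⟨rfl, hx⟩
    · exact hx.ne rfl
    · exact hx.1 rfl
    · exact hx.1 rfl⟩

variable {G : SimpleGraph V} {h : V}

theorem le_hubJoin : G ≤ G.hubJoin h := fun _ _ hxy => Or.inl hxy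

theorem hubJoin_connected : (G.hubJoin h).Connected := by
  refine (connected_iff_exists_forall_reachable _).2 ⟨h, fun x => ?_⟩
  by_cases hx : G.connectedComponentMk x = G.connectedComponentMk h
  · exact (ConnectedComponent.exact hx).symm.mono le_hubJoin
  · set y := (G.connectedComponentMk x).out with hy
    have hxy : G.connectedComponentMk y = G.connectedComponentMk x := Quot.out_eq _
    have h1 : (G.hubJoin h).Adj h y :=
      Or.inr (Or.inl ⟨rfl, by rwa [hxy], by rw [hxy]⟩)
    exact h1.reachable.trans ((ConnectedComponent.exact hxy).mono le_hubJoin)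

/-- A walk avoiding this edge cannot leave the component of `y`: the component has only one
representative and does not contain `h`. -/
theorem IsForeignRep.isBridge {y : V} (hy : G.IsForeignRep h y) :
    (G.hubJoin h).IsBridge s(y, h) := by
  rw [isBridge_iff]
  rintro ⟨p⟩
  have key : ∀ {a b : V} (p : ((G.hubJoin h).deleteEdges {s(y, h)}).Walk a b),
      G.connectedComponentMk a = G.connectedComponentMk y →
      G.connectedComponentMk b = G.connectedComponentMk y := by
    intro a b p
    induction p with
    | nil => exact id
    | @cons a b c hab p ih =>
      intro ha
      refine ih ?_
      rw [deleteEdges_adj] at hab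
      rcases hab.1 with h1 | ⟨rfl, -⟩ | ⟨rfl, h1⟩
      · rw [← ha]
        exact ConnectedComponent.sound h1.symm.reachable
      · exact absurd ha.symm hy.1
      · have : a = y := by rw [← h1.2, ha, hy.2]
        subst this
        exact absurd rfl hab.2
  exact hy.1 (key p rfl).symm

theorem egirth_le_egirth_hubJoin : G.egirth ≤ (G.hubJoin h).egirth := by
  refine egirth_le_egirth_of_isBridge fun x y hxy hn => ?_
  rcases hxy with h1 | ⟨rfl, h1⟩ | ⟨rfl, h1⟩
  · exact absurd h1 hn
  · rw [Sym2.eq_swap]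
    exact h1.isBridge
  · exact h1.isBridge

theorem hubJoin_adj_of_forall_not_adj {x : V} (hx : ∀ y, ¬ G.Adj x y) (hne : x ≠ h) :
    (G.hubJoin h).Adj x h := by
  have key : ∀ y, G.Reachable x y → x = y := by
    rintro y ⟨p⟩
    cases p with
    | nil => rfl
    | cons hxy p => exact absurd hxy (hx _)
  refine Or.inr (Or.inr ⟨rfl, fun hc => hne (key _ (ConnectedComponent.exact hc)), ?_⟩)
  exact (key _ (ConnectedComponent.exact (Quot.out_eq (G.connectedComponentMk x))).symm).symm

end HubJoin

section Copies

variable {N : ℕ} [NeZero N]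

/-- `M` disjoint copies of `H`, one after the other, followed by isolated vertices. -/
def copies (H : SimpleGraph (Fin N)) (M n : ℕ) : SimpleGraph (Fin n) where
  Adj x y := (x : ℕ) / N = y / N ∧ (x : ℕ) < M * N ∧ (y : ℕ) < M * N ∧
    H.Adj (Fin.ofNat N x) (Fin.ofNat N y)
  symm := ⟨fun _ _ h => ⟨h.1.symm, h.2.2.1, h.2.1, h.2.2.2.symm⟩⟩
  loopless := ⟨fun _ h => h.2.2.2.ne rfl⟩

variable {H : SimpleGraph (Fin N)} {M n : ℕ}

/-- Reduction modulo `N` is injective on each copy. -/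
theorem NoShortClosed.copies {m : ℕ} (h : H.NoShortClosed m) :
    (H.copies M n).NoShortClosed m := by
  refine h.of_map (fun x => Fin.ofNat N x) (fun x y hxy => hxy.2.2.2) ?_
  intro x y z hx hz he
  have h1 : (x : ℕ) % N = z % N := congrArg Fin.val he
  have h2 : (x : ℕ) / N = z / N := hx.1.symm.trans hz.1
  apply Fin.ext
  rw [← Nat.div_add_mod x N, ← Nat.div_add_mod z N, h1, h2]

open Classical in
theorem le_card_copies_adj {q : ℕ} (hH : ∀ v, q ≤ (H.neighborSet v).ncard) (hn : M * N ≤ n)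
    {x : Fin n} (hx : (x : ℕ) < M * N) :
    q ≤ (Finset.univ.filter fun y => (H.copies M n).Adj x y).card := by
  have hN : 0 < N := Nat.pos_of_neZero N
  have hb : ∀ w : Fin N, N * ((x : ℕ) / N) + w < M * N := by
    intro w
    have h1 : (x : ℕ) / N < M := Nat.div_lt_of_lt_mul (by rwa [mul_comm])
    have h2 := w.2
    nlinarith
  have h0 : (Finset.univ.filter fun w => H.Adj (Fin.ofNat N x) w).card =
      (H.neighborSet (Fin.ofNat N x)).ncard := by
    rw [← Set.ncard_coe_finset]
    congr 1
    ext w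
    simp
  refine ((hH (Fin.ofNat N x)).trans_eq h0.symm).trans (Finset.card_le_card_of_injOn
    (fun w => (⟨N * ((x : ℕ) / N) + w, (hb w).trans_le hn⟩ : Fin n)) ?_ ?_)
  · intro w hw
    have hw' : H.Adj (Fin.ofNat N x) w := by simpa using hw
    simp only [Finset.coe_filter, Finset.mem_univ, true_and, Set.mem_ofPred_eq]
    refine ⟨?_, hx, hb w, ?_⟩
    · simp [Nat.mul_add_div hN, Nat.div_eq_of_lt w.2]
    · convert hw'
      apply Fin.ext
      simp [Nat.mod_eq_of_lt w.2]
  · intro a _ b _ hab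
    have := congrArg Fin.val hab
    exact Fin.ext (by simpa using this)

end Copies

end SimpleGraph

/-! ### Orienting a graph into a profile -/

namespace Profile

variable {V : Type} [LinearOrder V] [Fintype V]

open Classical in
/-- The profile in which every player buys the links of `G` to the smaller players. -/
def ofGraph (G : SimpleGraph V) : Profile V where
  bought u := {v | G.Adj u v ∧ v < u}
  irrefl u := by simp

variable {G : SimpleGraph V}

theorem mem_bought_ofGraph {u v : V} : v ∈ (ofGraph G).bought u ↔ G.Adj u v ∧ v < u := by
  simp [ofGraph]

theorem network_ofGraph : (ofGraph G).network = G := by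
  ext u v
  change v ∈ (ofGraph G).bought u ∨ u ∈ (ofGraph G).bought v ↔ _
  rw [mem_bought_ofGraph, mem_bought_ofGraph]
  constructor
  · rintro (h | h)
    · exact h.1
    · exact h.1.symm
  · intro h
    rcases lt_or_gt_of_ne h.ne with h1 | h1
    · exact Or.inr ⟨h.symm, h1⟩
    · exact Or.inl ⟨h, h1⟩

theorem bought_ofGraph_asymm (u v : V) (h : v ∈ (ofGraph G).bought u) :
    u ∉ (ofGraph G).bought v := by
  rw [mem_bought_ofGraph] at h ⊢
  exact fun h' => lt_asymm h.2 h'.2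

open Classical in
theorem two_mul_sum_card_bought_ofGraph :
    2 * ∑ u, ((ofGraph G).bought u).card = ∑ u, (Finset.univ.filter fun v => G.Adj u v).card := by
  have h1 : ∀ u, (Finset.univ.filter fun v => G.Adj u v).card =
      ((ofGraph G).bought u).card + (Finset.univ.filter fun v => G.Adj u v ∧ u < v).card := by
    intro u
    rw [← Finset.card_union_of_disjoint]
    · congr 1
      ext v
      rw [Finset.mem_union, mem_bought_ofGraph]
      simp only [Finset.mem_filter, Finset.mem_univ, true_and]
      constructor
      · intro h
        rcases lt_or_gt_of_ne h.ne with h1 | h1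
        · exact Or.inr ⟨h, h1⟩
        · exact Or.inl ⟨h, h1⟩
      · rintro (h | h) <;> exact h.1
    · rw [Finset.disjoint_left]
      intro v hv hv'
      rw [mem_bought_ofGraph] at hv
      exact lt_asymm hv.2 (Finset.mem_filter.1 hv').2.2
  have h2 : ∑ u, (Finset.univ.filter fun v => G.Adj u v ∧ u < v).card =
      ∑ u, ((ofGraph G).bought u).card := by
    simp only [ofGraph, Finset.card_filter]
    rw [Finset.sum_comm]
    simp only [G.adj_comm]
  simp only [h1, Finset.sum_add_distrib, h2]
  ring

end Profile

/-! ### Dense regular graphs of large girth from unitriangular matrices -/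

namespace AlternatingMatrix

open Matrix

variable {F : Type} [Field F] {k : ℕ}

/-- The superdiagonal matrix supported on the rows whose index has parity `b`. -/
def gen (F : Type) [Field F] (k : ℕ) (b : Bool) : Matrix (Fin (k + 1)) (Fin (k + 1)) F :=
  Matrix.of fun i j => if (j : ℕ) = i + 1 ∧ (i : ℕ).bodd = b then 1 else 0

theorem vecMul_gen_zero (v : Fin (k + 1) → F) (b : Bool) : (v ᵥ* gen F k b) 0 = 0 := by
  simp [Matrix.vecMul, dotProduct, gen]

theorem vecMul_gen_succ (v : Fin (k + 1) → F) (b : Bool) {l : ℕ} (h : l + 1 < k + 1) :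
    (v ᵥ* gen F k b) ⟨l + 1, h⟩ = if l.bodd = b then v ⟨l, by lia⟩ else 0 := by
  simp only [Matrix.vecMul, dotProduct, gen, Matrix.of_apply, mul_ite, mul_one, mul_zero]
  rw [Finset.sum_eq_single ⟨l, by lia⟩]
  · simp
  · intro i _ hi
    rw [if_neg]
    rintro ⟨h1, -⟩
    exact hi (Fin.ext (by simp only at h1 ⊢; lia))
  · simp

theorem mul_gen_zero (M : Matrix (Fin (k + 1)) (Fin (k + 1)) F) (b : Bool) (i : Fin (k + 1)) :
    (M * gen F k b) i 0 = 0 := vecMul_gen_zero (M i) b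

theorem mul_gen_succ (M : Matrix (Fin (k + 1)) (Fin (k + 1)) F) (b : Bool) (i : Fin (k + 1))
    {l : ℕ} (h : l + 1 < k + 1) :
    (M * gen F k b) i ⟨l + 1, h⟩ = if l.bodd = b then M i ⟨l, by lia⟩ else 0 :=
  vecMul_gen_succ (M i) b h

/-- Consecutive superdiagonal steps use rows of opposite parity. The vanishing square makes `1 + a •
gen F k b` additive in `a`. -/
theorem gen_mul_gen (b : Bool) : gen F k b * gen F k b = 0 := by
  ext i ⟨j, hj⟩
  rcases j with _ | j
  · exact mul_gen_zero _ b i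
  · rw [mul_gen_succ]
    split_ifs with h
    · rw [gen, Matrix.of_apply, if_neg, Matrix.zero_apply]
      rintro ⟨h1, h2⟩
      simp only at h1
      rw [h1, Nat.bodd_succ, h2] at h
      simp at h
    · rfl

/-- Right multiplication by the elementary matrix `1 + a • gen F k b`. -/
def act (b : Bool) (a : F) (M : Matrix (Fin (k + 1)) (Fin (k + 1)) F) :
    Matrix (Fin (k + 1)) (Fin (k + 1)) F :=
  M + a • (M * gen F k b)

theorem act_zero (b : Bool) (M : Matrix (Fin (k + 1)) (Fin (k + 1)) F) : act b 0 M = M := by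
  simp [act]

theorem act_act (b : Bool) (a a' : F) (M : Matrix (Fin (k + 1)) (Fin (k + 1)) F) :
    act b a' (act b a M) = act b (a + a') M := by
  simp only [act, add_mul, smul_mul_assoc, mul_assoc, gen_mul_gen, mul_zero, smul_zero, add_zero,
    add_smul, add_assoc]

/-- The upper unitriangular matrices which are invariant under moving two steps down the
diagonal. -/
def edges (F : Type) [Field F] (k : ℕ) : Set (Matrix (Fin (k + 1)) (Fin (k + 1)) F) :=
  {M | (∀ i j, j < i → M i j = 0) ∧ (∀ i, M i i = 1) ∧
    ∀ (i j : ℕ) (hi : i + 2 < k + 1) (hj : j + 2 < k + 1),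
      M ⟨i + 2, hi⟩ ⟨j + 2, hj⟩ = M ⟨i, by lia⟩ ⟨j, by lia⟩}

theorem one_mem_edges : (1 : Matrix (Fin (k + 1)) (Fin (k + 1)) F) ∈ edges F k := by
  refine ⟨fun i j h => Matrix.one_apply_ne h.ne', fun i => Matrix.one_apply_eq i, ?_⟩
  intro i j hi hj
  simp [Matrix.one_apply]

theorem act_mem_edges {M : Matrix (Fin (k + 1)) (Fin (k + 1)) F} (hM : M ∈ edges F k) (b : Bool)
    (a : F) : act b a M ∈ edges F k := by
  obtain ⟨h1, h2, h3⟩ := hM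
  have hlow : ∀ i j : Fin (k + 1), j ≤ i → (M * gen F k b) i j = 0 := by
    rintro i ⟨j, hj⟩ hij
    rcases j with _ | j
    · exact mul_gen_zero M b i
    · rw [mul_gen_succ, h1, ite_self]
      rw [Fin.le_def] at hij
      rw [Fin.lt_def]
      exact hij
  refine ⟨fun i j hij => ?_, fun i => ?_, fun i j hi hj => ?_⟩
  · simp [act, h1 i j hij, hlow i j hij.le]
  · simp [act, h2 i, hlow i i le_rfl]
  · simp only [act, Matrix.add_apply, Matrix.smul_apply]
    rw [h3 i j hi hj, mul_gen_succ M b _ (l := j + 1)]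
    congr 2
    rcases j with _ | j
    · rw [h1 ⟨i + 2, hi⟩ _ (by rw [Fin.lt_def]; simp), ite_self]
      exact (mul_gen_zero M b _).symm
    · rw [mul_gen_succ M b _ (l := j), h3 i j]
      simp

theorem det_eq_one {M : Matrix (Fin (k + 1)) (Fin (k + 1)) F} (hM : M ∈ edges F k) :
    M.det = 1 := by
  rw [Matrix.det_of_isUpperTriangular (fun i j h => hM.1 i j h)]
  exact Finset.prod_eq_one fun i _ => hM.2.1 i

/-- In row `b.toNat`, the entry right of the diagonal is changed by `a` on one side and not at all
on the other. For `b = true` this is column 2, whence `2 ≤ k`. -/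
theorem eq_zero_of_act_eq_act (hk : 2 ≤ k) {M : Matrix (Fin (k + 1)) (Fin (k + 1)) F}
    (hM : M ∈ edges F k) {b : Bool} {a c : F} (h : act b a M = act (!b) c M) : a = 0 := by
  have hl : b.toNat + 1 < k + 1 := by have := b.toNat_le; lia
  have h1 := congrFun (congrFun h ⟨b.toNat, by lia⟩) ⟨b.toNat + 1, hl⟩
  have h2 : b.toNat.bodd = b := by cases b <;> rfl
  simp only [act, Matrix.add_apply, Matrix.smul_apply, mul_gen_succ, h2] at h1
  simpa [hM.2.1] using h1

/-- Shift invariance leaves only the first two rows, with `k` and `k - 1` free entries. -/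
theorem card_edges_le [Fintype F] (hk : 1 ≤ k) :
    Nat.card (edges F k) ≤ Fintype.card F ^ (2 * k - 1) := by
  let f : edges F k → (Fin k → F) × (Fin (k - 1) → F) := fun M =>
    (fun i => M.1 0 ⟨i + 1, by lia⟩, fun i => M.1 ⟨1, by lia⟩ ⟨i + 2, by lia⟩)
  have hf : Function.Injective f := by
    rintro ⟨M, h1, h2, h3⟩ ⟨M', h1', h2', h3'⟩ h
    refine Subtype.ext ?_
    have h4 := congrArg Prod.fst h
    have h5 := congrArg Prod.snd h
    have key : ∀ i j : ℕ, ∀ (hi : i < k + 1) (hj : j < k + 1),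
        M ⟨i, hi⟩ ⟨j, hj⟩ = M' ⟨i, hi⟩ ⟨j, hj⟩ := by
      intro i
      induction i using Nat.strong_induction_on with
      | _ i ih =>
        intro j hi hj
        rcases lt_trichotomy j i with hlt | heq | hgt
        · rw [h1 _ _ (Fin.lt_def.2 hlt), h1' _ _ (Fin.lt_def.2 hlt)]
        · subst heq
          rw [h2, h2']
        · rcases i with _ | _ | i
          · have := congrFun h4 ⟨j - 1, by lia⟩
            simpa [f, Nat.sub_add_cancel hgt] using this
          · have := congrFun h5 ⟨j - 2, by lia⟩
            simpa [f, Nat.sub_add_cancel hgt] using this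
          · obtain ⟨j, rfl⟩ := Nat.exists_eq_add_of_le' (by lia : 2 ≤ j)
            rw [h3, h3']
            exact ih i (by lia) j (by lia) (by lia)
    ext i j
    exact key i j i.2 j.2
  have := Nat.card_le_card_of_injective f hf
  refine this.trans_eq ?_
  rw [Nat.card_prod, Nat.card_eq_fintype_card, Nat.card_eq_fintype_card, Fintype.card_fun,
    Fintype.card_fun, Fintype.card_fin, Fintype.card_fin, ← pow_add]
  congr 1
  lia

/-- The orbits of right multiplication by the elementary matrices of parity `b`. -/
def orbitSetoid (F : Type) [Field F] (k : ℕ) (b : Bool) : Setoid (edges F k) where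
  r M M' := ∃ a, M'.1 = act b a M.1
  iseqv :=
    { refl := fun M => ⟨0, (act_zero b M.1).symm⟩
      symm := by
        rintro M M' ⟨a, h⟩
        exact ⟨-a, by rw [h, act_act, add_neg_cancel, act_zero]⟩
      trans := by
        rintro M M' M'' ⟨a, h⟩ ⟨a', h'⟩
        exact ⟨a + a', by rw [h', h, act_act]⟩ }

/-- The vertices of the incidence graph of the two families of orbits. -/
abbrev Vertex (F : Type) [Field F] (k : ℕ) : Type :=
  Σ b : Bool, Quotient (orbitSetoid F k b)

/-- The orbit of parity `b` of a matrix. -/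
def orbit (b : Bool) (M : edges F k) : Vertex F k := ⟨b, Quotient.mk _ M⟩

theorem orbit_eq_orbit {b : Bool} {M M' : edges F k} :
    orbit b M = orbit b M' ↔ ∃ a, M'.1 = act b a M.1 := by
  rw [orbit, orbit, Sigma.mk.injEq]
  simp only [heq_eq_eq, true_and]
  exact Quotient.eq

theorem fst_orbit (b : Bool) (M : edges F k) : (orbit b M).1 = b := rfl

/-- The incidence graph of the two families of orbits. -/
def orbitGraph (F : Type) [Field F] (k : ℕ) : SimpleGraph (Vertex F k) where
  Adj x y := ∃ b M, x = orbit b M ∧ y = orbit (!b) M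
  symm := ⟨by
    rintro x y ⟨b, M, rfl, rfl⟩
    exact ⟨!b, M, rfl, by simp⟩⟩
  loopless := ⟨by
    rintro x ⟨b, M, h, h'⟩
    have := congrArg Sigma.fst (h.symm.trans h')
    simp [fst_orbit] at this⟩

theorem exists_eq_orbit (x : Vertex F k) : ∃ b M, x = orbit b M := by
  obtain ⟨b, M⟩ := x
  exact ⟨b, M.out, by rw [orbit, Quotient.out_eq]⟩

/-- The action on the set of edges of the orbit graph. -/
def actEdge (b : Bool) (a : F) (M : edges F k) : edges F k := ⟨act b a M.1, act_mem_edges M.2 b a⟩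

theorem ncard_neighborSet_orbitGraph [Fintype F] (hk : 2 ≤ k) (x : Vertex F k) :
    ((orbitGraph F k).neighborSet x).ncard = Fintype.card F := by
  obtain ⟨b, M, rfl⟩ := exists_eq_orbit x
  have h1 : (orbitGraph F k).neighborSet (orbit b M) =
      (fun a => orbit (!b) (actEdge b a M)) '' Set.univ := by
    ext y
    simp only [SimpleGraph.mem_neighborSet, Set.image_univ, Set.mem_range]
    constructor
    · rintro ⟨c, M', h, rfl⟩
      have hc : b = c := congrArg Sigma.fst h
      subst hc
      obtain ⟨a, ha⟩ := orbit_eq_orbit.1 h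
      exact ⟨a, congrArg _ (Subtype.ext ha.symm)⟩
    · rintro ⟨a, rfl⟩
      exact ⟨b, actEdge b a M, orbit_eq_orbit.2 ⟨a, rfl⟩, rfl⟩
  rw [h1, Set.ncard_image_of_injective, Set.ncard_univ, Nat.card_eq_fintype_card]
  intro a a' h
  obtain ⟨c, hc⟩ := orbit_eq_orbit.1 h
  have h2 : act b (a' - a) (actEdge b a M).1 = act (!b) c (actEdge b a M).1 := by
    rw [← hc]
    simp [actEdge, act_act]
  exact (sub_eq_zero.1 (eq_zero_of_act_eq_act hk (actEdge b a M).2 h2)).symm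

/-- Each orbit has `q` elements, among at most `q ^ (2k - 1)` matrices. -/
theorem card_vertex_le [Fintype F] (hk : 2 ≤ k) :
    Nat.card (Vertex F k) ≤ 2 * Fintype.card F ^ (2 * k - 2) := by
  have h1 : ∀ b, Nat.card (Quotient (orbitSetoid F k b)) ≤ Fintype.card F ^ (2 * k - 2) := by
    intro b
    have h2 : Nat.card (Quotient (orbitSetoid F k b) × F) ≤ Nat.card (edges F k) := by
      refine Nat.card_le_card_of_injective (fun x => actEdge b x.2 x.1.out) ?_
      rintro ⟨x, a⟩ ⟨y, c⟩ h
      have h3 : act b a x.out.1 = act b c y.out.1 := congrArg Subtype.val h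
      have h4 : x = y := by
        rw [← Quotient.out_equiv_out]
        exact ⟨a - c, by rw [sub_eq_add_neg, ← act_act, h3, act_act, add_neg_cancel, act_zero]⟩
      subst h4
      have h5 := congrArg (act b (-c)) h3
      rw [act_act, act_act, add_neg_cancel, act_zero] at h5
      have h6 := eq_zero_of_act_eq_act (c := 0) hk x.out.2 (h5.trans (act_zero _ _).symm)
      rw [Prod.mk.injEq]
      exact ⟨rfl, by rwa [← sub_eq_add_neg, sub_eq_zero] at h6⟩
    have h3 := h2.trans (card_edges_le (by lia))
    rw [Nat.card_prod, Nat.card_eq_fintype_card (α := F),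
      show 2 * k - 1 = (2 * k - 2) + 1 by lia, pow_succ] at h3
    exact Nat.le_of_mul_le_mul_right h3 Fintype.card_pos
  rw [Nat.card_sigma, Fintype.sum_bool]
  have := h1 true
  have := h1 false
  lia

/-- The effect of an elementary matrix on a row vector. -/
def vecAct (b : Bool) (a : F) (v : Fin (k + 1) → F) : Fin (k + 1) → F :=
  v + a • (v ᵥ* gen F k b)

theorem vecMul_act (ρ : Fin (k + 1) → F) (b : Bool) (a : F)
    (M : Matrix (Fin (k + 1)) (Fin (k + 1)) F) : ρ ᵥ* act b a M = vecAct b a (ρ ᵥ* M) := by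
  rw [act, vecAct, Matrix.vecMul_add, Matrix.vecMul_smul, Matrix.vecMul_vecMul]

/-- Letters of parities `0, 1, 0, …` move the first basis vector on by one position each. -/
theorem vecAct_seq_ne_zero {s : ℕ} {v : ℕ → Fin (k + 1) → F} (h0 : v 0 = Pi.single 0 1)
    (h : ∀ i < s, ∃ a ≠ 0, v (i + 1) = vecAct i.bodd a (v i)) {i : ℕ} (hi : i ≤ s)
    (hik : i < k + 1) : v i ⟨i, hik⟩ ≠ 0 ∧ ∀ j : Fin (k + 1), i < j → v i j = 0 := by
  induction i with
  | zero =>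
    rw [h0]
    refine ⟨by simp, fun j hj => ?_⟩
    rw [Pi.single_eq_of_ne]
    rintro rfl
    simp at hj
  | succ i ih =>
    obtain ⟨a, ha, hv⟩ := h i (by lia)
    obtain ⟨h1, h2⟩ := ih (by lia) (by lia)
    rw [hv]
    constructor
    · simp only [vecAct, Pi.add_apply, Pi.smul_apply, vecMul_gen_succ, if_true]
      rw [h2 _ (by simp), zero_add]
      exact mul_ne_zero ha h1
    · rintro ⟨j, hj⟩ hij
      simp only at hij
      obtain ⟨j, rfl⟩ := Nat.exists_eq_add_of_le' (by lia : 1 ≤ j)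
      simp only [vecAct, Pi.add_apply, Pi.smul_apply, vecMul_gen_succ]
      rw [h2 _ (by simp only; lia), h2 _ (by simp only; lia)]
      simp

/-- Letters of parities `1, 0, 1, …` move the first basis vector on less far. -/
theorem vecAct_seq_eq_zero {s : ℕ} {v : ℕ → Fin (k + 1) → F} (h0 : v 0 = Pi.single 0 1)
    (h : ∀ i < s, ∃ a, v (i + 1) = vecAct (!i.bodd) a (v i)) {i : ℕ} (hi : i ≤ s)
    (j : Fin (k + 1)) (hj : 1 ≤ (j : ℕ)) (hij : i ≤ j) : v i j = 0 := by
  induction i generalizing j with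
  | zero =>
    rw [h0, Pi.single_eq_of_ne]
    rintro rfl
    simp at hj
  | succ i ih =>
    obtain ⟨a, hv⟩ := h i (by lia)
    obtain ⟨j, hjk⟩ := j
    simp only at hj hij
    obtain ⟨j, rfl⟩ := Nat.exists_eq_add_of_le' hj
    simp only [hv, vecAct, Pi.add_apply, Pi.smul_apply, vecMul_gen_succ]
    rw [ih (by lia) ⟨j + 1, hjk⟩ (by simp) (by simp only; lia), zero_add]
    split_ifs with hb
    · rcases Nat.eq_zero_or_pos j with rfl | hj0
      · obtain rfl : i = 0 := by lia
        simp at hb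
      · rw [ih (by lia) ⟨j, by lia⟩ hj0 (by simp only; lia), smul_zero]
    · simp

theorem noShortClosed_orbitGraph (hk : 2 ≤ k) : (orbitGraph F k).NoShortClosed (2 * k + 1) := by
  intro l f hl hlk hper hadj
  by_contra! hne
  choose b e hfe hfe' using hadj
  have hb : ∀ i, b (i + 1) = !b i := fun i => congrArg Sigma.fst ((hfe (i + 1)).symm.trans (hfe' i))
  have hb' : ∀ i, b i = (b 0 ^^ i.bodd) := by
    intro i
    induction i with
    | zero => simp
    | succ i ih => rw [hb, ih, Nat.bodd_succ]; simp
  have hbl : b l = b 0 := by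
    have h := hper 0
    rw [zero_add, hfe, hfe 0] at h
    exact congrArg Sigma.fst h
  have hl2 : l.bodd = false := by
    have h : ∀ x y : Bool, x = (x ^^ y) → y = false := by decide
    exact h _ _ (hbl.symm.trans (hb' l))
  have hstep : ∀ i, ∃ a ≠ 0, (e (i + 1)).1 = act (b (i + 1)) a (e i).1 := by
    intro i
    have h1 : orbit (b (i + 1)) (e i) = orbit (b (i + 1)) (e (i + 1)) := by
      rw [← hfe (i + 1), hfe' i, hb]
    obtain ⟨a, ha⟩ := orbit_eq_orbit.1 h1
    refine ⟨a, ?_, ha⟩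
    rintro rfl
    rw [act_zero] at ha
    apply hne i
    rw [hfe i, show i + 2 = i + 1 + 1 from rfl, hfe' (i + 1), Subtype.ext ha, hb]
    simp
  -- The walk closes up also in its edges: `e 0` and `e l` share both orbits, and orbits of opposite
  -- parity meet in at most one matrix.
  have hel : (e l).1 = (e 0).1 := by
    have h1 : orbit (b 0) (e 0) = orbit (b 0) (e l) := by
      rw [← hfe 0]
      conv_rhs => rw [← hbl, ← hfe l]
      simpa using (hper 0).symm
    have h2 : orbit (!b 0) (e 0) = orbit (!b 0) (e l) := by
      rw [← hfe' 0]
      conv_rhs => rw [← hbl, ← hfe' l]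
      have := (hper 1).symm
      rwa [add_comm 1 l] at this
    obtain ⟨a, ha⟩ := orbit_eq_orbit.1 h1
    obtain ⟨c, hc⟩ := orbit_eq_orbit.1 h2
    rw [ha, eq_zero_of_act_eq_act hk (e 0).2 (ha.symm.trans hc), act_zero]
  obtain ⟨s, rfl⟩ : ∃ s, l = 2 * s := by
    refine ⟨l / 2, ?_⟩
    have h := Nat.mod_two_of_bodd l
    rw [hl2] at h
    simp at h
    lia
  have hunit : IsUnit (e 0).1.det := by rw [det_eq_one (e 0).2]; exact isUnit_one
  -- `ρ` sends both `e 0` and `e (2 * s)` to the first basis vector; the two halves of the walk then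
  -- meet at `e s`.
  set ρ : Fin (k + 1) → F := Pi.single 0 1 ᵥ* (e 0).1⁻¹ with hρ
  have hρ0 : ρ ᵥ* (e 0).1 = Pi.single 0 1 := by
    rw [hρ, Matrix.vecMul_vecMul, Matrix.nonsing_inv_mul _ hunit, Matrix.vecMul_one]
  have hfwd : ∀ i < s, ∃ a ≠ 0, ρ ᵥ* (e (i + 1)).1 = vecAct (b 1 ^^ i.bodd) a (ρ ᵥ* (e i).1) := by
    intro i _
    obtain ⟨a, ha, h⟩ := hstep i
    refine ⟨a, ha, ?_⟩
    rw [h, vecMul_act]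
    congr 1
    rw [hb' (i + 1), hb' 1, Nat.bodd_succ]
    simp
  have hbwd : ∀ i < s, ∃ a ≠ 0, ρ ᵥ* (e (2 * s - (i + 1))).1 =
      vecAct (b 0 ^^ i.bodd) a (ρ ᵥ* (e (2 * s - i)).1) := by
    intro i hi
    obtain ⟨m, hm⟩ : ∃ m, 2 * s = m + 1 + i := ⟨2 * s - i - 1, by lia⟩
    rw [show 2 * s - (i + 1) = m by lia, show 2 * s - i = m + 1 by lia]
    obtain ⟨a, ha, h⟩ := hstep m
    refine ⟨-a, neg_ne_zero.2 ha, ?_⟩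
    have h1 : (e m).1 = act (b (m + 1)) (-a) (e (m + 1)).1 := by
      rw [h, act_act, add_neg_cancel, act_zero]
    have h2 : (m + 1).bodd = i.bodd := by
      rw [hm, Nat.bodd_add] at hl2
      have h : ∀ x y : Bool, (x ^^ y) = false → x = y := by decide
      exact h _ _ hl2
    rw [h1, vecMul_act, hb' (m + 1), h2]
  have hs : s < k + 1 := by lia
  have h2s : 2 * s - s = s := by lia
  have h20 : ρ ᵥ* (e (2 * s - 0)).1 = Pi.single 0 1 := by rw [Nat.sub_zero, hel, hρ0]
  -- The letters start with parity `b 1` forwards and `b 0` backwards. The half starting with parity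
  -- 0 makes coordinate `s ≤ k` nonzero, the other leaves it zero.
  cases hb0 : b 0 with
  | true =>
    have hb1 : b 1 = false := by rw [hb 0, hb0]; rfl
    rw [hb1] at hfwd
    rw [hb0] at hbwd
    have h1 := (vecAct_seq_ne_zero (v := fun i => ρ ᵥ* (e i).1) (s := s) hρ0
      (fun i hi => by simpa using hfwd i hi) le_rfl hs).1
    have h2 := vecAct_seq_eq_zero (v := fun i => ρ ᵥ* (e (2 * s - i)).1) (s := s) h20
      (fun i hi => by obtain ⟨a, -, h⟩ := hbwd i hi; exact ⟨a, by simpa using h⟩) le_rfl ⟨s, hs⟩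
      (by simp only; lia) le_rfl
    simp only [h2s] at h2
    exact h1 h2
  | false =>
    have hb1 : b 1 = true := by rw [hb 0, hb0]; rfl
    rw [hb1] at hfwd
    rw [hb0] at hbwd
    have h1 := (vecAct_seq_ne_zero (v := fun i => ρ ᵥ* (e (2 * s - i)).1) (s := s) h20
      (fun i hi => by simpa using hbwd i hi) le_rfl hs).1
    have h2 := vecAct_seq_eq_zero (v := fun i => ρ ᵥ* (e i).1) (s := s) hρ0
      (fun i hi => by obtain ⟨a, -, h⟩ := hfwd i hi; exact ⟨a, by simpa using h⟩) le_rfl ⟨s, hs⟩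
      (by simp only; lia) le_rfl
    simp only [h2s] at h1
    exact h1 h2

end AlternatingMatrix

-- One connected component keeps degrees and girth; only an upper bound on its size is needed.
open AlternatingMatrix SimpleGraph in
theorem exists_regular_noShortClosed {k q : ℕ} (hk : 2 ≤ k) (hq : IsPrimePow q) :
    ∃ (N : ℕ) (H : SimpleGraph (Fin N)), H.Connected ∧ (∀ v, (H.neighborSet v).ncard = q) ∧
      H.NoShortClosed (2 * k + 1) ∧ N ≤ 2 * q ^ (2 * k - 2) := by
  obtain ⟨p, m, hp, hm, rfl⟩ := (isPrimePow_nat_iff q).1 hq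
  have : Fact p.Prime := ⟨hp⟩
  let F := GaloisField p m
  have : Fintype F := Fintype.ofFinite F
  have hF : Fintype.card F = p ^ m := by
    rw [← Nat.card_eq_fintype_card, GaloisField.card p m hm.ne']
  set G := orbitGraph F k with hG
  set C := G.connectedComponentMk (orbit true ⟨1, one_mem_edges⟩) with hC
  have : Fintype C := Fintype.ofFinite C
  let φ := C.toSimpleGraph.overFinIso rfl
  have hinj : Function.Injective (fun v => (φ.symm v : Vertex F k)) :=
    Subtype.val_injective.comp φ.symm.injective
  have hadj : ∀ x y, (C.toSimpleGraph.overFin rfl).Adj x y ↔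
      G.Adj (φ.symm x : Vertex F k) (φ.symm y) := fun x y => φ.symm.map_rel_iff.symm
  refine ⟨Fintype.card C, C.toSimpleGraph.overFin rfl,
    φ.connected_iff.1 C.connected_toSimpleGraph, ?_, ?_, ?_⟩
  · intro v
    rw [← hF, ← ncard_neighborSet_orbitGraph hk (φ.symm v : Vertex F k),
      ← Set.ncard_image_of_injective _ hinj]
    congr 1
    ext y
    simp only [Set.mem_image, mem_neighborSet]
    constructor
    · rintro ⟨w, hw, rfl⟩
      exact (hadj _ _).1 hw
    · intro hy
      have hyC : y ∈ C.supp := (C.mem_supp_congr_adj hy).1 (φ.symm v).2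
      refine ⟨φ ⟨y, hyC⟩, (hadj _ _).2 (by simpa using hy), by simp⟩
  · exact (noShortClosed_orbitGraph hk).of_map _ (fun x y h => (hadj x y).1 h)
      (fun x y z _ _ h => hinj h)
  · rw [← hF]
    refine le_trans ?_ (card_vertex_le hk)
    rw [← Nat.card_eq_fintype_card]
    exact Nat.card_le_card_of_injective _ Subtype.val_injective

/-! ### Bounds for the social cost and the optimum -/

namespace Profile

open SimpleGraph

variable {V : Type} [Fintype V] {α : ℝ} {σ : Profile V}

omit [Fintype V] in
theorem coe_sum_real (s : Finset V) (f : V → ℝ) :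
    ((∑ u ∈ s, f u : ℝ) : EReal) = ∑ u ∈ s, (f u : EReal) :=
  map_sum (⟨⟨Real.toEReal, EReal.coe_zero⟩, EReal.coe_add⟩ : ℝ →+ EReal) f s

theorem socialCost_le {m : ℕ} (h : ∀ u, σ.network.eccent u ≤ m) :
    σ.socialCost α ≤
      ((α * ∑ u, ((σ.bought u).card : ℝ) + Fintype.card V * m : ℝ) : EReal) := by
  refine (Finset.sum_le_sum fun u _ => cost_le_coe_add_natCast (h u)).trans_eq ?_
  rw [← coe_sum_real, Finset.sum_add_distrib, Finset.mul_sum]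
  simp

theorem le_socialCost {m : ℕ} (h : ∀ u, (m : ℕ∞) ≤ σ.network.eccent u) :
    ((α * ∑ u, ((σ.bought u).card : ℝ) + Fintype.card V * m : ℝ) : EReal) ≤ σ.socialCost α := by
  refine Eq.trans_le ?_ (Finset.sum_le_sum fun u _ => coe_add_natCast_le_cost (h u))
  rw [← coe_sum_real, Finset.sum_add_distrib, Finset.mul_sum]
  simp

open Classical in
/-- The profile in which the player `c` buys the links to all other players. -/
def star (c : V) : Profile V where
  bought u := if u = c then Finset.univ.erase c else ∅
  irrefl u := by
    split_ifs with h
    · simp [h]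
    · simp

theorem star_adj {c v : V} (h : v ≠ c) : (star c).network.Adj c v := by
  left
  simp [star, h]

theorem eccent_star_le (c u : V) : (star c).network.eccent u ≤ 2 := by
  have h1 : ∀ v, (star c).network.edist c v ≤ 1 := by
    intro v
    by_cases h : v = c
    · simp [h]
    · exact (edist_eq_one_iff_adj.2 (star_adj h)).le
  refine (eccent_le_iff _ _).2 fun v => (SimpleGraph.edist_triangle (v := c)).trans ?_
  rw [SimpleGraph.edist_comm, ← one_add_one_eq_two]
  exact add_le_add (h1 u) (h1 v)

theorem sum_card_bought_star_le (c : V) :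
    ∑ u, (((star c).bought u).card : ℝ) ≤ Fintype.card V := by
  rw [Finset.sum_eq_single c]
  · have : ((star c).bought c).card ≤ Fintype.card V := Finset.card_le_univ _
    exact_mod_cast this
  · intro u _ hu
    simp [star, hu]
  · simp

end Profile

section Ratio

variable {V : Type} [Fintype V] {α : ℝ}

theorem optimalCost_le [Nonempty V] (hα : 1 ≤ α) :
    optimalCost α V ≤ ((3 * α * Fintype.card V : ℝ) : EReal) := by
  obtain ⟨c⟩ := ‹Nonempty V›
  refine (iInf_le _ (Profile.star c)).trans
    ((Profile.socialCost_le (m := 2) (Profile.eccent_star_le c)).trans ?_)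
  rw [EReal.coe_le_coe_iff]
  have h1 := Profile.sum_card_bought_star_le c
  have h2 : (0 : ℝ) ≤ Fintype.card V := Nat.cast_nonneg _
  push_cast
  nlinarith

theorem optimalCost_pos [Nontrivial V] (hα : 1 ≤ α) : 0 < optimalCost α V := by
  refine lt_of_lt_of_le (b := ((1 : ℝ) : EReal)) (by simp) (le_iInf fun σ => ?_)
  refine le_trans ?_ (Profile.le_socialCost (m := 1) fun u =>
    Order.one_le_iff_ne_zero.2 (SimpleGraph.eccent_ne_zero u))
  rw [EReal.coe_le_coe_iff]
  have h1 : (1 : ℝ) ≤ Fintype.card V := by exact_mod_cast Fintype.card_pos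
  have h2 : 0 ≤ ∑ u, ((σ.bought u).card : ℝ) := Finset.sum_nonneg fun _ _ => Nat.cast_nonneg _
  push_cast
  nlinarith

/-- Eccentricities are dropped from the social cost, so `α` cancels against the `3 α n` of the star.
-/
theorem coe_le_socialCost_div_optimalCost [Nontrivial V] (hα : 1 ≤ α) {σ : Profile V} {r : ℝ}
    (hr : 0 ≤ r) (h : r * (3 * Fintype.card V) ≤ ∑ u, ((σ.bought u).card : ℝ)) :
    (r : EReal) ≤ σ.socialCost α / optimalCost α V := by
  have hle := optimalCost_le (V := V) hα
  rw [EReal.le_div_iff_mul_le (optimalCost_pos hα)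
    (ne_top_of_le_ne_top (EReal.coe_ne_top _) hle)]
  refine (mul_le_mul_of_nonneg_left hle (EReal.coe_nonneg.2 hr)).trans
    (le_trans ?_ (Profile.le_socialCost (m := 0) fun u => by simp))
  rw [← EReal.coe_mul, EReal.coe_le_coe_iff]
  push_cast
  nlinarith

end Ratio

theorem rpow_one_div_le {k : ℕ} (hk : 2 ≤ k) {x y : ℝ} (hx : 0 ≤ x) (hy : 0 ≤ y)
    (h : x ≤ y ^ (2 * k - 2)) : x ^ (1 / (2 * (k : ℝ) - 2)) ≤ y := by
  have h1 : 2 * (k : ℝ) - 2 = ((2 * k - 2 : ℕ) : ℝ) := by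
    rw [Nat.cast_sub (by lia)]
    push_cast
    ring
  rw [h1, one_div]
  refine (Real.rpow_le_rpow hx h (by positivity)).trans_eq ?_
  exact Real.pow_rpow_inv_natCast hy (by lia)

theorem two_mul_pow_le {k : ℕ} (hk : 2 ≤ k) {y : ℝ} (hy : 0 ≤ y) :
    2 * y ^ (2 * k - 2) ≤ (2 * y) ^ (2 * k - 2) := by
  rw [mul_pow]
  gcongr
  exact le_self_pow₀ one_le_two (by lia)

/-! ### Assembling the equilibria -/

open Profile SimpleGraph

open Classical in
theorem SimpleGraph.card_filter_adj_eq_ncard {V : Type} [Fintype V] (G : SimpleGraph V) (v : V) :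
    (Finset.univ.filter fun w => G.Adj v w).card = (G.neighborSet v).ncard := by
  rw [← Set.ncard_coe_finset]
  congr 1
  ext w
  simp

theorem exists_regular_isLKE {k q : ℕ} (hk : 2 ≤ k) (hq3 : 3 ≤ q) (hq : IsPrimePow q) :
    ∃ (n : ℕ) (σ : Profile (Fin n)),
      (∀ v, (σ.network.neighborSet v).ncard = q) ∧
      ((2 * k + 2 : ℕ) : ℕ∞) ≤ σ.network.egirth ∧
      1 / 48 * (n : ℝ) ^ (1 + 1 / (2 * (k : ℝ) - 2)) ≤ (σ.network.edgeSet.ncard : ℝ) ∧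
      ∀ α : ℝ, 1 ≤ α →
        σ.IsLKE α k ∧
        ((1 / 48 * (n : ℝ) ^ (1 / (2 * (k : ℝ) - 2)) : ℝ) : EReal) ≤
          σ.socialCost α / optimalCost α (Fin n) := by
  classical
  obtain ⟨n, H, hc, hreg, hns, hn⟩ := exists_regular_noShortClosed hk hq
  have hg : ((2 * k + 2 : ℕ) : ℕ∞) ≤ H.egirth := hns.le_egirth
  have hdeg : ∀ v, (Finset.univ.filter fun w => H.Adj v w).card = q := fun v =>
    (H.card_filter_adj_eq_ncard v).trans (hreg v)
  have hnbr : ∀ v, ∃ w, H.Adj v w := by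
    intro v
    obtain ⟨w, hw⟩ := Finset.card_pos.1 (by rw [hdeg v]; lia :
      0 < (Finset.univ.filter fun w => H.Adj v w).card)
    exact ⟨w, by simpa using hw⟩
  have : Nontrivial (Fin n) := by
    obtain ⟨v⟩ := hc.nonempty
    obtain ⟨w, hw⟩ := hnbr v
    exact ⟨v, w, hw.ne⟩
  have hroot : (n : ℝ) ^ (1 / (2 * (k : ℝ) - 2)) ≤ 2 * q :=
    rpow_one_div_le hk (Nat.cast_nonneg n) (by positivity)
      (le_trans (by exact_mod_cast hn) (two_mul_pow_le hk (Nat.cast_nonneg q)))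
  have hn0 : 0 < n := by
    obtain ⟨v⟩ := hc.nonempty
    exact v.pos
  refine ⟨n, ofGraph H, ?_, ?_, ?_, fun α hα => ⟨?_, ?_⟩⟩
  · rwa [network_ofGraph]
  · rwa [network_ofGraph]
  · rw [network_ofGraph]
    have h1 : 2 * H.edgeSet.ncard = n * q := by
      have h2 := H.sum_degrees_eq_twice_card_edges
      have h3 : ∀ v, H.degree v = q := fun v => by
        rw [← hdeg v, ← H.card_neighborFinset_eq_degree v]
        congr 1
        ext w
        simp
      rw [Finset.sum_congr rfl fun v _ => h3 v] at h2
      rw [Set.ncard_eq_toFinset_card']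
      simpa [edgeFinset] using h2.symm
    have h2 : 2 * (H.edgeSet.ncard : ℝ) = n * q := by exact_mod_cast h1
    rw [Real.rpow_add (by exact_mod_cast hn0), Real.rpow_one]
    have h3 := mul_le_mul_of_nonneg_left hroot (Nat.cast_nonneg (α := ℝ) n)
    have h4 : (0 : ℝ) ≤ n * q := by positivity
    linarith
  · refine isLKE_of_le_egirth (S := Finset.univ) (by lia) ?_ ?_ bought_ofGraph_asymm ?_
      (fun u => Finset.subset_univ _) ?_ hα
    · rwa [network_ofGraph]
    · rwa [network_ofGraph]
    · intro v _
      rw [network_ofGraph, hdeg v]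
      exact hq3
    · intro v
      obtain ⟨w, hw⟩ := hnbr v
      exact ⟨w, Finset.mem_univ _, by rwa [network_ofGraph]⟩
  · refine coe_le_socialCost_div_optimalCost hα (by positivity) ?_
    have h1 := two_mul_sum_card_bought_ofGraph (G := H)
    simp only [hdeg, Finset.sum_const, Finset.card_univ, Fintype.card_fin, smul_eq_mul] at h1
    have h2 : 2 * ∑ u, (((ofGraph H).bought u).card : ℝ) = n * q := by exact_mod_cast h1
    have h3 := mul_le_mul_of_nonneg_right hroot (Nat.cast_nonneg (α := ℝ) n)
    have h4 : (0 : ℝ) ≤ n * q := by positivity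
    rw [Fintype.card_fin]
    linarith

theorem exists_isLKE_of_card {k q n : ℕ} (hk : 2 ≤ k) (hq3 : 3 ≤ q) (hq : IsPrimePow q)
    (hn : 2 * q ^ (2 * k - 2) ≤ n) {α : ℝ} (hα : 1 ≤ α) :
    ∃ σ : Profile (Fin n), σ.IsLKE α k ∧ n * q ≤ 4 * ∑ u, (σ.bought u).card := by
  classical
  obtain ⟨N, H, hc, hreg, hns, hN⟩ := exists_regular_noShortClosed hk hq
  obtain ⟨v0⟩ := hc.nonempty
  have hN0 : 0 < N := v0.pos
  have : NeZero N := ⟨hN0.ne'⟩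
  have hn0 : 0 < n := by lia
  have : NeZero n := ⟨hn0.ne'⟩
  set M := n / N with hM
  have hM1 : 1 ≤ M := (Nat.one_le_div_iff hN0).2 (hN.trans hn)
  have hMn : M * N ≤ n := Nat.div_mul_le_self n N
  -- At least half of the players lie in copies.
  have hMn2 : n ≤ 2 * (M * N) := by
    have h1 := Nat.lt_div_mul_add (a := n) hN0
    rw [← hM] at h1
    have h2 := Nat.mul_le_mul_right N hM1
    lia
  have hMN : 0 < M * N := Nat.mul_pos hM1 hN0
  set G := (H.copies M n).hubJoin 0 with hG
  set S : Finset (Fin n) := {x | (x : ℕ) < M * N} with hS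
  have hmemS : ∀ x, x ∈ S ↔ (x : ℕ) < M * N := fun x => by simp [hS]
  have h0S : (0 : Fin n) ∈ S := (hmemS 0).2 (by simpa using hMN)
  have hcardS : M * N = S.card := by
    rw [hS, Fin.card_filter_val_lt, min_eq_right hMn]
  have hdegS : ∀ v ∈ S, q ≤ {x ∈ S | G.Adj v x}.card := by
    intro v hv
    refine (le_card_copies_adj (fun w => (hreg w).ge) hMn ((hmemS v).1 hv)).trans
      (Finset.card_le_card fun x hx => ?_)
    have hx' := (Finset.mem_filter.1 hx).2
    exact Finset.mem_filter.2 ⟨(hmemS x).2 hx'.2.2.1, le_hubJoin hx'⟩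
  refine ⟨ofGraph G, isLKE_of_le_egirth (S := S) (by lia) ?_ ?_ bought_ofGraph_asymm ?_ ?_ ?_ hα, ?_⟩
  · rw [network_ofGraph]
    exact hubJoin_connected
  · rw [network_ofGraph]
    exact hns.copies.le_egirth.trans egirth_le_egirth_hubJoin
  · intro v hv
    rw [network_ofGraph]
    exact hq3.trans (hdegS v hv)
  · intro u v hv
    rw [mem_bought_ofGraph] at hv
    -- The hub `0` is the smallest player and buys nothing, so each bridge is bought at its other
    -- end and ends in `S`.
    rcases hv.1 with h | ⟨rfl, -⟩ | ⟨rfl, -⟩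
    · exact (hmemS v).2 h.2.2.1
    · exact absurd hv.2 (Fin.not_lt_zero v)
    · exact h0S
  · intro u
    rw [network_ofGraph]
    by_cases hu : u ∈ S
    · obtain ⟨w, hw⟩ := Finset.card_pos.1 (lt_of_lt_of_le (by lia) (hdegS u hu))
      exact ⟨w, (Finset.mem_filter.1 hw).1, (Finset.mem_filter.1 hw).2⟩
    · refine ⟨0, h0S, hubJoin_adj_of_forall_not_adj (fun y hy => hu ((hmemS u).2 hy.2.1)) ?_⟩
      rintro rfl
      exact hu h0S
  · have h1 := two_mul_sum_card_bought_ofGraph (G := G)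
    have h2 : S.card * q ≤ ∑ u, (Finset.univ.filter fun v => G.Adj u v).card := by
      rw [← smul_eq_mul]
      refine (Finset.card_nsmul_le_sum S _ q fun v hv => (hdegS v hv).trans
        (Finset.card_le_card fun x hx => ?_)).trans
        (Finset.sum_le_sum_of_subset (Finset.subset_univ S))
      exact Finset.mem_filter.2 ⟨Finset.mem_univ _, (Finset.mem_filter.1 hx).2⟩
    rw [← hcardS, ← h1] at h2
    have h3 := Nat.mul_le_mul_right q hMn2
    rw [mul_assoc] at h3
    lia

theorem two_mul_four_pow_le {k n : ℕ} (hk : 2 ≤ k) (hn : 1 ≤ n)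
    (h : (k : ℝ) ≤ 1 / 3 * Real.log n) :
    2 * 4 ^ (2 * k - 2) ≤ n := by
  have hn' : (0 : ℝ) < n := by exact_mod_cast hn
  have h1 : Real.exp (3 * k) ≤ n := by
    rw [← Real.le_log_iff_exp_le hn']
    linarith
  have h2 : (16 : ℝ) ≤ Real.exp 3 := by
    have h3 := Real.exp_one_gt_d9
    have h4 : Real.exp 3 = Real.exp 1 ^ 3 := by rw [← Real.exp_nat_mul]; norm_num
    rw [h4]
    calc (16 : ℝ) ≤ 2.7 ^ 3 := by norm_num
      _ ≤ Real.exp 1 ^ 3 := by gcongr; linarith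
  have h3 : (16 : ℝ) ^ k ≤ n := by
    refine (pow_le_pow_left₀ (by norm_num) h2 k).trans ?_
    rwa [← Real.exp_nat_mul, mul_comm]
  have h4 : 16 ^ k ≤ n := by exact_mod_cast h3
  refine le_trans ?_ h4
  calc 2 * 4 ^ (2 * k - 2) ≤ 4 ^ 2 * 4 ^ (2 * k - 2) := Nat.mul_le_mul_right _ (by norm_num)
    _ = 4 ^ (2 * k) := by rw [← pow_add]; congr 1; lia
    _ = 16 ^ k := by rw [pow_mul]; norm_num

theorem le_priceOfAnarchy {k n : ℕ} (hk : 2 ≤ k) (hn : 2 * 4 ^ (2 * k - 2) ≤ n) {α : ℝ}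
    (hα : 1 ≤ α) :
    ((1 / 48 * (n : ℝ) ^ (1 / (2 * (k : ℝ) - 2)) : ℝ) : EReal) ≤ priceOfAnarchy α k (Fin n) := by
  classical
  -- The largest power of two that fits gives `q ≥ 4` with `n < 2 (2q) ^ (2k - 2)`.
  have hex : ∃ i, n < 2 * (2 ^ i) ^ (2 * k - 2) := by
    refine ⟨n, Nat.lt_two_pow_self.trans_le ?_⟩
    exact (Nat.le_self_pow (by lia) _).trans (Nat.le_mul_of_pos_left _ two_pos)
  obtain ⟨i, hi⟩ : ∃ i, Nat.find hex = i + 1 + 2 := by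
    refine Nat.exists_eq_add_of_le' (?_ : 1 + 2 ≤ Nat.find hex)
    rw [Nat.le_find_iff]
    intro m hm
    rw [not_lt]
    refine le_trans ?_ hn
    have : (2 : ℕ) ^ m ≤ 2 ^ 2 := Nat.pow_le_pow_right two_pos (by lia)
    gcongr
    exact this
  have h1 : 2 * (2 ^ (i + 2)) ^ (2 * k - 2) ≤ n := not_lt.1 (Nat.find_min hex (by lia))
  have h2 : n < 2 * (2 * 2 ^ (i + 2)) ^ (2 * k - 2) := by
    have := Nat.find_spec hex
    rwa [hi, show i + 1 + 2 = (i + 2) + 1 by lia, pow_succ' 2 (i + 2)] at this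
  have h4 : 4 ≤ 2 ^ (i + 2) := by
    have := Nat.pow_le_pow_right two_pos (by lia : 2 ≤ i + 2)
    simpa using this
  set q := 2 ^ (i + 2) with hq
  have hqp : IsPrimePow q := Nat.prime_two.isPrimePow.pow (by lia)
  obtain ⟨σ, hσ, hsum⟩ := exists_isLKE_of_card hk (by lia) hqp h1 hα
  have hn2 : 2 ≤ n := by
    have := Nat.one_le_pow (2 * k - 2) 4 (by lia)
    lia
  have : Nontrivial (Fin n) := Fin.nontrivial_iff_two_le.2 hn2
  refine le_trans ?_ (le_iSup₂ (f := fun (σ : Profile (Fin n)) (_ : σ.IsLKE α k) =>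
    σ.socialCost α / optimalCost α (Fin n)) σ hσ)
  refine coe_le_socialCost_div_optimalCost hα (by positivity) ?_
  -- The `2k - 2`-th root of `n` is at most `4q`, and the links divided by `3n` number at least `q /
  -- 12`: hence `1 / 48`.
  have hroot : (n : ℝ) ^ (1 / (2 * (k : ℝ) - 2)) ≤ 2 * (2 * q) :=
    rpow_one_div_le hk (Nat.cast_nonneg n) (by positivity)
      (le_trans (by exact_mod_cast h2.le) (two_mul_pow_le hk (by positivity)))
  have h5 : (n : ℝ) * q ≤ 4 * ∑ u, ((σ.bought u).card : ℝ) := by exact_mod_cast hsum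
  have h6 := mul_le_mul_of_nonneg_right hroot (Nat.cast_nonneg (α := ℝ) n)
  rw [Fintype.card_fin]
  linarith

end

theorem mainTheorem4 :
    ∃ c : ℝ, 0 < c ∧
      (∀ (k : ℕ → ℕ) (α : ℕ → ℝ),
        (∀ n, 2 ≤ k n) →
        (fun n => (k n : ℝ)) =o[atTop] (fun n : ℕ => Real.log (n : ℝ)) →
        (∀ n, 1 ≤ α n) →
        ∀ᶠ n : ℕ in atTop,
          ((c * (n : ℝ) ^ (1 / (2 * (k n : ℝ) - 2)) : ℝ) : EReal) ≤
            priceOfAnarchy (α n) (k n) (Fin n)) ∧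
      (∀ k q : ℕ, 2 ≤ k → 3 ≤ q → IsPrimePow q →
        ∃ (n : ℕ) (σ : Profile (Fin n)),
          (∀ v, (σ.network.neighborSet v).ncard = q) ∧
          ((2 * k + 2 : ℕ) : ℕ∞) ≤ σ.network.egirth ∧
          c * (n : ℝ) ^ (1 + 1 / (2 * (k : ℝ) - 2)) ≤ (σ.network.edgeSet.ncard : ℝ) ∧
          ∀ α : ℝ, 1 ≤ α →
            σ.IsLKE α k ∧
            ((c * (n : ℝ) ^ (1 / (2 * (k : ℝ) - 2)) : ℝ) : EReal) ≤
              σ.socialCost α / optimalCost α (Fin n)) := by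
  refine ⟨1 / 48, by norm_num, fun k α hk ho hα => ?_, fun k q hk hq3 hq =>
    exists_regular_isLKE hk hq3 hq⟩
  -- The bound `k ≤ (log n) / 3` yields `2 * 4 ^ (2k - 2) ≤ 16 ^ k ≤ exp (3k) ≤ n`, so that `q = 4`
  -- fits.
  filter_upwards [ho.bound (by norm_num : (0 : ℝ) < 1 / 3), eventually_ge_atTop 1] with n hn hn1
  refine le_priceOfAnarchy (hk n) (two_mul_four_pow_le (hk n) hn1 ?_) (hα n)
  rwa [Real.norm_of_nonneg (Nat.cast_nonneg _),
    Real.norm_of_nonneg (Real.log_nonneg (by exact_mod_cast hn1))] at hn
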